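/- Let $N\ge 1$, let $\Omega\subset\mathbb R^N$ be a bounded domain (nonempty, open, connected), let $A,b_0>0$, $\sigma\in(0,2)$, $m>\max\{1,\sigma\}$, $\theta\in[0,m)$, and put $$\gamma_0=\min\Big\{\frac{m-\sigma}{m},\frac{m-\theta}{m}\Big\}.$$ Write $B_\delta(x)$ for the open ball, $B_\delta=B_\delta(0)$, $B=B_1$, and $d_\Omega(x)=\operatorname{dist}(x,\partial\Omega)$ for $x\in\Omega$. Let $\{\nu_x\}_{x\in\mathbb R^N}$ be a family of (nonnegative) Borel measures on $\mathbb R^N$ satisfying: (M1) for all $R>0$, $\alpha\in[0,2]$ there is $C^{1}_{R,\alpha}>0$ such that for all $\delta>0$ $$\sup_{x\in\overline B_R}\int_{B_\delta^c}\min\{1,|z|^\alpha\}\,\nu_x(dz)\le C^{1}_{R,\alpha}\,h_{\alpha,\sigma}(\delta),$$ where $h_{\alpha,\sigma}(\delta)=\delta^{\alpha-\sigma}$ if $\alpha<\sigma$, $=|\ln\delta|+1$ if $\alpha=\sigma$, $=1$ if $\alpha>\sigma$; (M2) for all $R>0$, $\alpha\in(\sigma,2]$ there is $C^{2}_{R,\alpha}>0$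 such that for all $\delta\in(0,1)$ $$\sup_{x\in\overline B_R}\int_{B_\delta}|z|^\alpha\,\nu_x(dz)\le C^{2}_{R,\alpha}\,\delta^{\alpha-\sigma}.$$ For $S\subset\mathbb R^N$, $p\in\mathbb R^N$ let $$I_x[S](\phi,x,p)=\int_S\big[\phi(x+z)-\phi(x)-\mathbf 1_B(z)\langle p,z\rangle\big]\nu_x(dz)\quad\text{if }\sigma\ge1,$$ and the same without the term $\mathbf 1_B(z)\langle p,z\rangle$ if $\sigma<1$. A bounded Borel function $u:\mathbb R^N\to\mathbb R$ is a viscosity subsolution of $$-I_x(u,x)+b_0|Du(x)|^m=A\big(d_\Omega(x)^{-\theta}+1\big),\qquad x\in\Omega,\tag{P'}$$ if it is upper semicontinuous in $\Omega$ and, whenever $x\in\Omega$, $\delta>0$, $\phi\in C^2(\mathbb R^N)$ and $u-\phi$ has at $x$ a maximum over $B_\delta(x)$, $$-I_x[B_\delta](\phi,x,D\phi(x))-I_x[B_\delta^c](u,x,D\phi(x))+b_0|D\phi(x)|^m\le A\big(d_\Omega(x)^{-\theta}+1\big).$$ Let $\Omega_\nu=\Omega\cup\bigcup_{x\in\overline\Omega}(x+\operatorname{supp}\nu_x)$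 and $\operatorname{osc}_{\Omega_\nu}(u)=\sup_{\Omega_\nu}u-\inf_{\Omega_\nu}u$. Then every bounded viscosity subsolution $u:\mathbb R^N\to\mathbb R$ of (P') is locally Hölder continuous in $\Omega$ with exponent $\gamma_0$, with seminorm controlled by the data, $\Omega$ and the oscillation. Precisely: for every $M$ there is a constant $K\ge0$, depending only on $N,\Omega,A,b_0,\sigma,m,\theta$, the constants $C^1_{R,\alpha},C^2_{R,\alpha}$ in (M1)-(M2), and $M$, such that for every such family $\{\nu_x\}$ and every such $u$ with $\operatorname{osc}_{\Omega_\nu}(u)\le M$: 1. for every ball $B_r(x_0)\subset\Omega$, $\ |u(x)-u(y)|\le K|x-y|^{\gamma_0}$ for all $x,y\in B_r(x_0)$; 2. if moreover $\Omega$ has a $C^{1,1}$ boundary (near each boundary point $\Omega$ is, in suitable orthonormal coordinates, the epigraph of a $C^1$ function with Lipschitz gradient), then $u|_\Omega$ extends to a function $v$ on $\overline\Omega$ with $|v(x)-v(y)|\le K|x-y|^{\gamma_0}$ for all $x,y\in\overline\Omega$. -/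

import Mathlib

open MeasureTheory Set Metric

/-- The Euclidean space `ℝᴺ`. -/
abbrev RN (N : ℕ) : Type := EuclideanSpace ℝ (Fin N)

noncomputable section

/-- The distance from a point of `Ω` to the boundary of `Ω`. -/
def bdryDist {N : ℕ} (Ω : Set (RN N)) (x : RN N) : ℝ := infDist x (frontier Ω)

/-- The function `h_{α,σ}(δ)`, for `δ > 0`. -/
def hFun (α σ δ : ℝ) : ℝ :=
  if α < σ then δ ^ (α - σ) else if α = σ then |Real.log δ| + 1 else 1

/-- Condition (M1) of order `σ`, where `C R α` is the constant attached to `R` and `α`. -/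
def CondM1 {N : ℕ} (σ : ℝ) (ν : RN N → Measure (RN N)) (C : ℝ → ℝ → ℝ) : Prop :=
  ∀ R : ℝ, 0 < R → ∀ α ∈ Icc (0 : ℝ) 2, 0 < C R α ∧
    ∀ δ : ℝ, 0 < δ → ∀ x ∈ closedBall (0 : RN N) R,
      ∫⁻ z in (ball (0 : RN N) δ)ᶜ, ENNReal.ofReal (min 1 (‖z‖ ^ α)) ∂(ν x)
        ≤ ENNReal.ofReal (C R α * hFun α σ δ)

/-- Condition (M2) of order `σ`, where `C R α` is the constant attached to `R` and `α`. -/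
def CondM2 {N : ℕ} (σ : ℝ) (ν : RN N → Measure (RN N)) (C : ℝ → ℝ → ℝ) : Prop :=
  ∀ R : ℝ, 0 < R → ∀ α ∈ Ioc σ 2, 0 < C R α ∧
    ∀ δ ∈ Ioo (0 : ℝ) 1, ∀ x ∈ closedBall (0 : RN N) R,
      ∫⁻ z in ball (0 : RN N) δ, ENNReal.ofReal (‖z‖ ^ α) ∂(ν x)
        ≤ ENNReal.ofReal (C R α * δ ^ (α - σ))

/-- The integrand of the nonlocal operator: `φ(x+z) - φ(x) - 1_B(z) ⟨p, z⟩` if `σ ≥ 1`, and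
`φ(x+z) - φ(x)` if `σ < 1`; here `B` is the open unit ball. -/
def levyIntegrand {N : ℕ} (σ : ℝ) (φ : RN N → ℝ) (x p z : RN N) : ℝ :=
  φ (x + z) - φ x -
    (if σ < 1 then 0 else (ball (0 : RN N) 1).indicator (fun z => inner ℝ p z) z)

/-- The nonlocal operator `I_ξ[S](φ, x, p)`: the integral over `S` against `ν_ξ`. -/
def levyOp {N : ℕ} (σ : ℝ) (ν : RN N → Measure (RN N)) (ξ : RN N) (S : Set (RN N))
    (φ : RN N → ℝ) (x p : RN N) : ℝ :=
  ∫ z in S, levyIntegrand σ φ x p z ∂(ν ξ)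

/-- `u` is a viscosity subsolution of `-I_x(u, x) + b₀ |Du(x)|^m = f(x)` in `Ω`: it is upper
semicontinuous in `Ω`, and whenever `φ` is `C²` and `u - φ` has a maximum over `B_δ(x)` at
`x ∈ Ω`, the inequality holds at `x` with `φ` used inside `B_δ` and `u` outside. -/
def IsViscositySubsolution {N : ℕ} (Ω : Set (RN N)) (σ : ℝ) (ν : RN N → Measure (RN N))
    (b₀ m : ℝ) (f : RN N → ℝ) (u : RN N → ℝ) : Prop :=
  UpperSemicontinuousOn u Ω ∧
  ∀ x ∈ Ω, ∀ φ : RN N → ℝ, ContDiff ℝ 2 φ → ∀ δ : ℝ, 0 < δ →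
    (∀ y ∈ ball x δ, u y - φ y ≤ u x - φ x) →
      - levyOp σ ν x (ball 0 δ) φ x (gradient φ x)
        - levyOp σ ν x (ball 0 δ)ᶜ u x (gradient φ x)
        + b₀ * ‖gradient φ x‖ ^ m ≤ f x

/-- The set `Ω_ν = Ω ∪ ⋃_{x ∈ closure Ω} (x + supp ν_x)` reachable from `Ω`. -/
def reachSet {N : ℕ} (Ω : Set (RN N)) (ν : RN N → Measure (RN N)) : Set (RN N) :=
  Ω ∪ ⋃ x ∈ closure Ω, (fun z => x + z) '' (ν x).support

/-- The oscillation `sup_S u - inf_S u` (of a bounded function over a nonempty set). -/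
def oscOn {N : ℕ} (u : RN N → ℝ) (S : Set (RN N)) : ℝ := sSup (u '' S) - sInf (u '' S)

/-- `Ω` has a `C^{1,1}` boundary: near each boundary point, in suitable orthogonal coordinates
with last axis spanned by the unit vector `n`, `Ω` is the strict epigraph of a `C¹` function with
Lipschitz gradient. The vector `x - ⟨n, x⟩ n` is the projection of `x` onto the hyperplane `n^⊥`,
so only the restriction of `g` to this hyperplane matters. -/
def HasC11Boundary {N : ℕ} (Ω : Set (RN N)) : Prop :=
  ∀ p ∈ frontier Ω, ∃ r : ℝ, 0 < r ∧ ∃ n : RN N, ‖n‖ = 1 ∧ ∃ g : RN N → ℝ,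
    ContDiff ℝ 1 g ∧ (∃ L : NNReal, LipschitzWith L (fderiv ℝ g)) ∧
    ∀ x ∈ ball p r, x ∈ Ω ↔ g (x - (inner ℝ n x) • n) < inner ℝ n x

/-- The exponent `min {(m - σ)/m, (m - θ)/m}`. -/
def holderExp (m σ θ : ℝ) : ℝ := min ((m - σ) / m) ((m - θ) / m)

/-- `|v(x) - v(y)| ≤ K |x - y|^γ` for all `x, y ∈ S`. -/
def HolderBoundOn {N : ℕ} (K γ : ℝ) (v : RN N → ℝ) (S : Set (RN N)) : Prop :=
  ∀ x ∈ S, ∀ y ∈ S, |v x - v y| ≤ K * ‖x - y‖ ^ γ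

end

/-! A subsolution cannot be touched from above by a steep paraboloid, because the gradient term
beats all others. Suppose a paraboloid of slope `p` and opening `H`, with `H * δ` at most a multiple
of `‖p‖`, touches `u` at `y` on a ball of radius `δ < 1` inside `Ω`. Then `y` is at distance at
least `δ` from the boundary, so up to constants the source costs `δ ^ (-θ)` and the nonlocal terms
cost `δ ^ (-σ) + ‖p‖ * δ ^ (σ / m - σ)`. With `E = δ ^ (γ - 1)`, the value of the exponent `γ` is
what bounds all this by `E ^ m + ‖p‖ * E ^ (m - 1)`. Since `m > 1`, the term `b₀ * ‖p‖ ^ m` wins as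
soon as `‖p‖ ≥ T * E` with `T` large (`exists_no_steep_paraboloid`).

A large multiple of the barrier is touched from above by exactly such steep paraboloids at every
point except the centre (`barrier_semiconcave`), and it is infinite on the sphere. Hence `u` minus
that multiple is maximal at the centre (`sub_le_barrier`). Exchanging centre and point makes the
bound two-sided: `LocalHolder`.

What remains is geometry. Local estimates sum geometrically along a sequence running into the vertex
of a cone in `Ω` (`LocalHolder.abs_sub_le_of_cone`). Such cones exist in balls and, up to the
boundary, in domains that are locally epigraphs of `C¹` functions. -/

/-! ### The radial barrier. -/

lemma rpow_le_tangent {β t s : ℝ} (hβ : 0 ≤ β) (hβ1 : β ≤ 1) (ht : 0 < t) (hs : 0 ≤ s) :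
    s ^ β ≤ t ^ β + β * t ^ (β - 1) * (s - t) := by
  have h := rpow_one_add_le_one_add_mul_self (s := s / t - 1)
    (by have := div_nonneg hs ht.le; linarith) hβ hβ1
  have h1 : 1 + (s / t - 1) = s / t := by ring
  rw [h1, Real.div_rpow hs ht.le, div_le_iff₀ (Real.rpow_pos_of_pos ht β)] at h
  refine h.trans (le_of_eq ?_)
  rw [Real.rpow_sub_one ht.ne']
  field_simp

/-- The radial function `‖y‖^γ + ρ^γ ‖y‖² / (ρ² - ‖y‖²)`, which blows up on the sphere of
radius `ρ`. -/
noncomputable def barrier {E : Type*} [NormedAddCommGroup E] (γ ρ : ℝ) (y : E) : ℝ :=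
  ‖y‖ ^ γ + ρ ^ γ * ‖y‖ ^ 2 / (ρ ^ 2 - ‖y‖ ^ 2)

section Barrier

variable {E : Type*} [NormedAddCommGroup E] {γ ρ : ℝ}

lemma barrier_zero (hγ : 0 < γ) : barrier γ ρ (0 : E) = 0 := by
  simp [barrier, hγ.ne']

/-- In the half ball the rational term is at most `4 / 3 * ρ ^ γ * (‖y‖ / ρ) ^ 2`, and there `(‖y‖ /
ρ) ^ 2 ≤ (‖y‖ / ρ) ^ γ`. -/
lemma barrier_le (hγ : 0 < γ) (hγ1 : γ ≤ 1) (hρ : 0 < ρ) {y : E} (hy : ‖y‖ ≤ ρ / 2) :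
    barrier γ ρ y ≤ 3 * ‖y‖ ^ γ := by
  have hq := norm_nonneg y
  have hd : 3 / 4 * ρ ^ 2 ≤ ρ ^ 2 - ‖y‖ ^ 2 := by nlinarith
  have h1 : (‖y‖ / ρ) ^ (2 : ℝ) ≤ (‖y‖ / ρ) ^ γ := by
    rcases hq.eq_or_lt with h | h
    · simp [← h, hγ.ne']
    · exact Real.rpow_le_rpow_of_exponent_ge (by positivity)
        ((div_le_one hρ).2 (by linarith)) (by linarith)
  rw [Real.div_rpow hq hρ.le γ, Real.rpow_two, div_pow,
    div_le_div_iff₀ (by positivity) (by positivity)] at h1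
  have h2 : ρ ^ γ * ‖y‖ ^ 2 / (ρ ^ 2 - ‖y‖ ^ 2) ≤ 2 * ‖y‖ ^ γ := by
    rw [div_le_iff₀ (by nlinarith [pow_pos hρ 2])]
    have := Real.rpow_nonneg hq γ
    nlinarith [pow_pos hρ 2]
  unfold barrier
  linarith

lemma continuousOn_barrier (hγ : 0 < γ) : ContinuousOn (barrier γ ρ : E → ℝ) (ball 0 ρ) := by
  unfold barrier
  refine ContinuousOn.add ((continuous_norm.rpow_const fun _ => Or.inr hγ.le).continuousOn)
    (ContinuousOn.div (by fun_prop) (by fun_prop) fun y hy => ?_)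
  rw [mem_ball_zero_iff] at hy
  nlinarith [norm_nonneg y]

/-- The barrier exceeds any given level close to the sphere of radius `ρ`. -/
lemma exists_radius_lt_barrier (hρ : 0 < ρ) (c : ℝ) :
    ∃ ρ' < ρ, ∀ y : E, ρ' < ‖y‖ → ‖y‖ < ρ → c < barrier γ ρ y := by
  have hpos := Real.rpow_pos_of_pos hρ γ
  -- The first entry of the minimum gives `‖y‖ > ρ / 2`; the second gives `ρ ^ 2 - ‖y‖ ^ 2 < ρ ^ γ *
  -- ρ ^ 2 / (4 * (|c| + 1))`, so the quotient exceeds `|c| + 1`.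
  refine ⟨ρ - min (ρ / 2) (ρ ^ γ * ρ / (8 * (|c| + 1))), ?_, fun y h1 h2 => ?_⟩
  · have : 0 < min (ρ / 2) (ρ ^ γ * ρ / (8 * (|c| + 1))) := lt_min (by positivity) (by positivity)
    linarith
  · have h3 : ρ / 2 < ‖y‖ := by linarith [min_le_left (ρ / 2) (ρ ^ γ * ρ / (8 * (|c| + 1)))]
    have h4 : ρ - ‖y‖ < ρ ^ γ * ρ / (8 * (|c| + 1)) := by
      linarith [min_le_right (ρ / 2) (ρ ^ γ * ρ / (8 * (|c| + 1)))]
    rw [lt_div_iff₀ (by positivity)] at h4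
    have h5 : c < ρ ^ γ * ‖y‖ ^ 2 / (ρ ^ 2 - ‖y‖ ^ 2) := by
      refine (le_abs_self c).trans_lt ?_
      rw [lt_div_iff₀ (by nlinarith)]
      have h6 : ρ ^ 2 - ‖y‖ ^ 2 ≤ 2 * ρ * (ρ - ‖y‖) := by nlinarith
      have h7 : |c| * (ρ ^ 2 - ‖y‖ ^ 2) ≤ |c| * (2 * ρ * (ρ - ‖y‖)) :=
        mul_le_mul_of_nonneg_left h6 (abs_nonneg c)
      have h8 : ρ ^ γ * (ρ / 2) ^ 2 ≤ ρ ^ γ * ‖y‖ ^ 2 := by gcongr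
      have h9 : 0 < ρ * (ρ - ‖y‖) := mul_pos hρ (by linarith)
      have h10 := mul_lt_mul_of_pos_left h4 hρ
      nlinarith
    have := Real.rpow_nonneg (norm_nonneg y) γ
    unfold barrier
    linarith

variable [InnerProductSpace ℝ E]

/-- Paraboloids touching the barrier from above. -/
lemma barrier_add_le (hγ : 0 ≤ γ) (hγ1 : γ ≤ 1) {y z : E} {δ : ℝ} (hδ0 : 0 < δ)
    (hδq : 4 * δ ≤ ‖y‖) (hδρ : 4 * δ ≤ ρ - ‖y‖) (hz : ‖z‖ ≤ δ) :
    barrier γ ρ (y + z) ≤ barrier γ ρ y +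
      ((γ * ‖y‖ ^ (γ - 2) + 2 * (ρ ^ γ * ρ ^ 2) / (ρ ^ 2 - ‖y‖ ^ 2) ^ 2) * inner ℝ y z +
        ((γ * ‖y‖ ^ (γ - 2) + 2 * (ρ ^ γ * ρ ^ 2) / (ρ ^ 2 - ‖y‖ ^ 2) ^ 2) / 2 +
          18 * (ρ ^ γ * ρ ^ 4) / (ρ ^ 2 - ‖y‖ ^ 2) ^ 3) * ‖z‖ ^ 2) := by
  obtain ⟨q, hq⟩ : ∃ q, q = ‖y‖ := ⟨_, rfl⟩
  rw [← hq] at hδq hδρ ⊢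
  have hq0 : 0 < q := by linarith
  have hy : q < ρ := by linarith
  have hρ : 0 < ρ := hq0.trans hy
  obtain ⟨D, hD⟩ : ∃ D, D = ρ ^ 2 - q ^ 2 := ⟨_, rfl⟩
  have hδD : 4 * δ * (ρ + q) ≤ D := by
    have := mul_le_mul_of_nonneg_right hδρ (by linarith : 0 ≤ ρ + q)
    linarith
  have hD0 : 0 < D := lt_of_lt_of_le (by positivity) hδD
  obtain ⟨P, hP⟩ : ∃ P, P = ρ ^ γ := ⟨_, rfl⟩
  have hP0 : 0 < P := hP ▸ Real.rpow_pos_of_pos hρ γ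
  rw [← hP, ← hD]
  obtain ⟨a, ha⟩ : ∃ a, a = γ * q ^ (γ - 2) + 2 * (P * ρ ^ 2) / D ^ 2 := ⟨_, rfl⟩
  rw [← ha]
  have hz0 := norm_nonneg z
  -- Both terms of the barrier are functions of the squared norm, whose increment is `t`: the power
  -- is concave in it and lies below its tangent, while the rational term needs a quadratic
  -- remainder.
  obtain ⟨t, ht⟩ : ∃ t, t = ‖y + z‖ ^ 2 - q ^ 2 := ⟨_, rfl⟩
  have ht1 : t = 2 * inner ℝ y z + ‖z‖ ^ 2 := by
    rw [ht, norm_add_sq_real, hq]; ring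
  have hin : |inner ℝ y z| ≤ q * ‖z‖ := hq ▸ abs_real_inner_le_norm y z
  have hin' := abs_le.1 hin
  have ht2 : |t| ≤ 3 * ρ * ‖z‖ := by
    have h1 : q * ‖z‖ ≤ ρ * ‖z‖ := mul_le_mul_of_nonneg_right hy.le hz0
    have h2 : ‖z‖ ^ 2 ≤ ρ * ‖z‖ := by
      rw [pow_two]; exact mul_le_mul_of_nonneg_right (by linarith) hz0
    have h3 := sq_nonneg ‖z‖
    rw [ht1, abs_le]; constructor <;> linarith [hin'.1, hin'.2]
  have ht3 : t ≤ D / 2 := by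
    have h1 : q * ‖z‖ ≤ q * δ := mul_le_mul_of_nonneg_left hz hq0.le
    have h2 : ‖z‖ * ‖z‖ ≤ δ * δ := mul_self_le_mul_self hz0 hz
    have h3 : δ * δ ≤ δ * ρ := mul_le_mul_of_nonneg_left (by linarith) hδ0.le
    have h4 := mul_pos hδ0 hρ
    have h5 := mul_pos hδ0 hq0
    linarith [hin'.2]
  have hconc : ‖y + z‖ ^ γ ≤ q ^ γ + γ / 2 * q ^ (γ - 2) * t := by
    have h := rpow_le_tangent (β := γ / 2) (t := q ^ 2) (s := ‖y + z‖ ^ 2) (by linarith)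
      (by linarith) (by positivity) (by positivity)
    rw [← ht, ← Real.rpow_natCast, ← Real.rpow_natCast, ← Real.rpow_mul hq0.le,
      ← Real.rpow_mul hq0.le, ← Real.rpow_mul (norm_nonneg _)] at h
    have e1 : ((2 : ℕ) : ℝ) * (γ / 2) = γ := by push_cast; ring
    have e2 : ((2 : ℕ) : ℝ) * (γ / 2 - 1) = γ - 2 := by push_cast; ring
    rwa [e1, e2] at h
  have hconv : P * ‖y + z‖ ^ 2 / (ρ ^ 2 - ‖y + z‖ ^ 2) ≤
      P * q ^ 2 / D + P * ρ ^ 2 / D ^ 2 * t + 18 * (P * ρ ^ 4) / D ^ 3 * ‖z‖ ^ 2 := by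
    have e1 : ‖y + z‖ ^ 2 = t + q ^ 2 := by rw [ht]; ring
    have e2 : ρ ^ 2 - ‖y + z‖ ^ 2 = D - t := by rw [e1, hD]; ring
    have e3 : 0 < D - t := by linarith
    have e4 : q ^ 2 = ρ ^ 2 - D := by rw [hD]; ring
    rw [e2, e1]
    -- Exact first-order expansion in `t`; the remainder is quadratic because `t ≤ D / 2` and `|t| ≤
    -- 3 * ρ * ‖z‖`.
    have e5 : P * (t + q ^ 2) / (D - t) =
        P * q ^ 2 / D + P * ρ ^ 2 / D ^ 2 * t + P * ρ ^ 2 / D ^ 2 * (t ^ 2 / (D - t)) := by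
      rw [e4]; field_simp; ring
    rw [e5]
    have e6 : t ^ 2 / (D - t) ≤ 18 * ρ ^ 2 * ‖z‖ ^ 2 / D := by
      rw [div_le_div_iff₀ e3 hD0]
      have e7 : t ^ 2 ≤ (3 * ρ * ‖z‖) ^ 2 := sq_le_sq' (by linarith [abs_le.1 ht2]) (abs_le.1 ht2).2
      calc t ^ 2 * D ≤ (3 * ρ * ‖z‖) ^ 2 * (2 * (D - t)) := by gcongr; linarith
        _ = _ := by ring
    have e8 : P * ρ ^ 2 / D ^ 2 * (t ^ 2 / (D - t)) ≤
        P * ρ ^ 2 / D ^ 2 * (18 * ρ ^ 2 * ‖z‖ ^ 2 / D) := by gcongr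
    have e9 : P * ρ ^ 2 / D ^ 2 * (18 * ρ ^ 2 * ‖z‖ ^ 2 / D) =
        18 * (P * ρ ^ 4) / D ^ 3 * ‖z‖ ^ 2 := by field_simp
    linarith
  have hsum : γ / 2 * q ^ (γ - 2) * t + P * ρ ^ 2 / D ^ 2 * t =
      a * inner ℝ y z + a / 2 * ‖z‖ ^ 2 := by
    rw [ht1, ha]; ring
  unfold barrier
  rw [← hP, ← hq, ← hD]
  linarith

/-- The barrier is locally touched from above by paraboloids `⟪p, z⟫ + H ‖z‖²`, where `p` is large
and `H` is controlled by `p` and the size `δ` of the neighbourhood. -/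
lemma barrier_semiconcave (hγ : 0 < γ) (hγ1 : γ ≤ 1) {y : E} (hy0 : y ≠ 0)
    (hy : ‖y‖ < ρ) :
    ∃ δ : ℝ, 0 < δ ∧ δ < ρ ∧ ‖y‖ + 2 * δ ≤ ρ ∧ ∃ p : E, ∃ H : ℝ, 0 ≤ H ∧
      γ / 64 * δ ^ (γ - 1) ≤ ‖p‖ ∧ H * δ ≤ 10 / γ * ‖p‖ ∧
      ∀ z : E, ‖z‖ ≤ δ →
        barrier γ ρ (y + z) ≤ barrier γ ρ y + (inner ℝ p z + H * ‖z‖ ^ 2) := by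
  obtain ⟨q, hq⟩ : ∃ q, q = ‖y‖ := ⟨_, rfl⟩
  have hq0 : 0 < q := hq ▸ norm_pos_iff.2 hy0
  rw [← hq] at hy
  have hρ : 0 < ρ := hq0.trans hy
  obtain ⟨D, hD⟩ : ∃ D, D = ρ ^ 2 - q ^ 2 := ⟨_, rfl⟩
  have hD0 : 0 < D := by rw [hD]; nlinarith
  -- A quarter of the distance to the two singular sets, the origin and the sphere.
  obtain ⟨δ, hδ⟩ : ∃ δ, δ = min q (ρ - q) / 4 := ⟨_, rfl⟩
  have hδq : 4 * δ ≤ q := by linarith [min_le_left q (ρ - q)]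
  have hδρ : 4 * δ ≤ ρ - q := by linarith [min_le_right q (ρ - q)]
  have hδ0 : 0 < δ := by rw [hδ]; exact div_pos (lt_min hq0 (by linarith)) (by norm_num)
  have hδD : 4 * δ * (ρ + q) ≤ D := by rw [hD]; nlinarith
  obtain ⟨P, hP⟩ : ∃ P, P = ρ ^ γ := ⟨_, rfl⟩
  have hP0 : 0 < P := hP ▸ Real.rpow_pos_of_pos hρ γ
  obtain ⟨a, ha⟩ : ∃ a, a = γ * q ^ (γ - 2) + 2 * (P * ρ ^ 2) / D ^ 2 := ⟨_, rfl⟩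
  have hq2 : 0 < q ^ (γ - 2) := Real.rpow_pos_of_pos hq0 _
  have ha1 : γ * q ^ (γ - 2) ≤ a := by rw [ha]; have : 0 ≤ 2 * (P * ρ ^ 2) / D ^ 2 := by positivity
                                       linarith
  have ha2 : 2 * (P * ρ ^ 2) / D ^ 2 ≤ a := by
    rw [ha]; have : 0 ≤ γ * q ^ (γ - 2) := by positivity
    linarith
  have ha0 : 0 < a := lt_of_lt_of_le (by positivity) ha1
  have hpn : ‖a • y‖ = a * q := by rw [norm_smul, Real.norm_of_nonneg ha0.le, hq]
  have hq1 : q ^ (γ - 2) * q = q ^ (γ - 1) := by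
    rw [← Real.rpow_add_one hq0.ne']; ring_nf
  have ha1' : γ * q ^ (γ - 1) ≤ a * q := by
    rw [← hq1, ← mul_assoc]; gcongr
  refine ⟨δ, hδ0, by linarith, by linarith, a • y, a / 2 + 18 * (P * ρ ^ 4) / D ^ 3,
    by positivity, ?_, ?_, fun z hz => ?_⟩
  · rw [hpn]
    -- Nearer the origin the slope of the power suffices; nearer the sphere `D ≤ 8 * ρ * δ` makes
    -- the slope of the rational term large.
    rcases le_total q (ρ - q) with h | h
    · have hδ' : q = 4 * δ := by rw [hδ, min_eq_left h]; ring
      refine le_trans ?_ ha1'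
      have h4 : (4 : ℝ) ^ (-1 : ℝ) ≤ 4 ^ (γ - 1) :=
        Real.rpow_le_rpow_of_exponent_le (by norm_num) (by linarith)
      rw [Real.rpow_neg_one] at h4
      rw [hδ', Real.mul_rpow (by norm_num) hδ0.le]
      have := Real.rpow_pos_of_pos hδ0 (γ - 1)
      have h5 : (1 / 64 : ℝ) ≤ 4 ^ (γ - 1) := by norm_num at h4 ⊢; linarith
      calc γ / 64 * δ ^ (γ - 1) = γ * (1 / 64 * δ ^ (γ - 1)) := by ring
        _ ≤ _ := by gcongr
    · have hδ' : ρ - q = 4 * δ := by rw [hδ, min_eq_right h]; ring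
      have h1 : D ≤ 8 * ρ * δ := by rw [hD]; nlinarith
      have h2 : δ ^ (γ - 1) * δ ^ 2 ≤ P * ρ := by
        rw [hP, ← Real.rpow_add_one hρ.ne', ← Real.rpow_two, ← Real.rpow_add hδ0]
        have : γ - 1 + 2 = γ + 1 := by ring
        rw [this]
        exact Real.rpow_le_rpow hδ0.le (by linarith) (by linarith)
      have h3 : P * ρ ^ 3 / D ^ 2 ≤ a * q := by
        calc P * ρ ^ 3 / D ^ 2 ≤ 2 * (P * ρ ^ 2) / D ^ 2 * q := by
              rw [div_mul_eq_mul_div]; gcongr ?_ / _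
              nlinarith [mul_pos hP0 (pow_pos hρ 2)]
          _ ≤ _ := by gcongr
      refine le_trans ?_ h3
      rw [le_div_iff₀ (by positivity)]
      have h4 := Real.rpow_pos_of_pos hδ0 (γ - 1)
      calc γ / 64 * δ ^ (γ - 1) * D ^ 2 ≤ 1 / 64 * δ ^ (γ - 1) * (8 * ρ * δ) ^ 2 := by gcongr
        _ = (δ ^ (γ - 1) * δ ^ 2) * ρ ^ 2 := by ring
        _ ≤ (P * ρ) * ρ ^ 2 := by gcongr
        _ = _ := by ring
  · rw [hpn]
    have h1 : 18 * (P * ρ ^ 4) / D ^ 3 * δ ≤ 9 / 2 * (P * ρ ^ 3) / D ^ 2 := by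
      rw [div_mul_eq_mul_div, div_le_div_iff₀ (by positivity) (by positivity)]
      have : 4 * δ * ρ ≤ D := by nlinarith
      calc 18 * (P * ρ ^ 4) * δ * D ^ 2 = 9 / 2 * (P * ρ ^ 3) * D ^ 2 * (4 * δ * ρ) := by ring
        _ ≤ 9 / 2 * (P * ρ ^ 3) * D ^ 2 * D := by gcongr
        _ = _ := by ring
    have h2 : 9 / 2 * (P * ρ ^ 3) / D ^ 2 ≤ 8 / γ * (a * q) := by
      have hγ8 : 8 ≤ 8 / γ := by rw [le_div_iff₀ hγ]; linarith
      -- The curvature of the rational term is absorbed by its own slope in the outer half; in the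
      -- inner half `D` is comparable to `ρ ^ 2` and the slope of the power absorbs it, as `γ ≤ 1`.
      rcases le_total (ρ / 2) q with h | h
      · calc 9 / 2 * (P * ρ ^ 3) / D ^ 2 ≤ 8 * (2 * (P * ρ ^ 2) / D ^ 2 * q) := by
              rw [div_mul_eq_mul_div (2 * (P * ρ ^ 2)), ← mul_div_assoc]; gcongr ?_ / _
              nlinarith [mul_pos hP0 (pow_pos hρ 2)]
          _ ≤ 8 / γ * (a * q) := by gcongr
      · have hD' : 3 / 4 * ρ ^ 2 ≤ D := by rw [hD]; nlinarith
        have h3 : 9 / 2 * (P * ρ ^ 3) / D ^ 2 ≤ 8 * ρ ^ (γ - 1) := by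
          rw [div_le_iff₀ (by positivity), Real.rpow_sub_one hρ.ne', ← hP]
          calc 9 / 2 * (P * ρ ^ 3) = 8 * (P / ρ) * (3 / 4 * ρ ^ 2) ^ 2 := by field_simp; norm_num
            _ ≤ _ := by gcongr
        have h4 : ρ ^ (γ - 1) ≤ q ^ (γ - 1) :=
          Real.rpow_le_rpow_of_nonpos hq0 hy.le (by linarith)
        calc 9 / 2 * (P * ρ ^ 3) / D ^ 2 ≤ 8 * ρ ^ (γ - 1) := h3
          _ ≤ 8 * q ^ (γ - 1) := by gcongr
          _ = 8 / γ * (γ * q ^ (γ - 1)) := by field_simp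
          _ ≤ _ := by gcongr
    have h3 : a / 2 * δ ≤ 2 / γ * (a * q) := by
      have hγ2 : 2 ≤ 2 / γ := by rw [le_div_iff₀ hγ]; linarith
      calc a / 2 * δ ≤ 2 * (a * q) := by nlinarith [mul_pos ha0 hq0]
        _ ≤ _ := by gcongr
    calc _ = a / 2 * δ + 18 * (P * ρ ^ 4) / D ^ 3 * δ := by ring
      _ ≤ 2 / γ * (a * q) + 8 / γ * (a * q) := by linarith
      _ = _ := by ring
  · have h := barrier_add_le hγ.le hγ1 hδ0 (hq ▸ hδq) (hq ▸ hδρ) hz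
    rw [← hq, ← hP, ← hD, ← ha] at h
    rwa [real_inner_smul_left]

end Barrier

/-! ### Oscillation and bounds on the nonlocal operator. -/

lemma abs_sub_le_oscOn {N : ℕ} {u : RN N → ℝ} {c : ℝ} (hu : ∀ x, |u x| ≤ c) {S : Set (RN N)}
    {x y : RN N} (hx : x ∈ S) (hy : y ∈ S) : |u x - u y| ≤ oscOn u S := by
  have ha : BddAbove (u '' S) := ⟨c, by rintro _ ⟨z, -, rfl⟩; exact (abs_le.1 (hu z)).2⟩
  have hb : BddBelow (u '' S) := ⟨-c, by rintro _ ⟨z, -, rfl⟩; exact (abs_le.1 (hu z)).1⟩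
  have h1 := le_csSup ha (mem_image_of_mem u hx)
  have h2 := le_csSup ha (mem_image_of_mem u hy)
  have h3 := csInf_le hb (mem_image_of_mem u hx)
  have h4 := csInf_le hb (mem_image_of_mem u hy)
  unfold oscOn
  rw [abs_le]; constructor <;> linarith

lemma subset_reachSet {N : ℕ} {Ω : Set (RN N)} {ν : RN N → Measure (RN N)} :
    Ω ⊆ reachSet Ω ν := subset_union_left

/-- The support carries all the mass of the measure, so the oscillation over `reachSet` controls
every increment that the operator sees. -/
lemma ae_add_mem_reachSet {N : ℕ} {Ω : Set (RN N)} {ν : RN N → Measure (RN N)} {y : RN N}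
    (hy : y ∈ Ω) : ∀ᵐ z ∂(ν y), y + z ∈ reachSet Ω ν := by
  filter_upwards [Measure.support_mem_ae (μ := ν y)] with z hz
  exact Or.inr (mem_biUnion (subset_closure hy) (mem_image_of_mem _ hz))

/-- A pointwise bound on the integrand bounds the integral of a real function. -/
lemma abs_setIntegral_le_of_lintegral_le {X : Type*} [MeasurableSpace X] {μ : Measure X}
    {S : Set X} (hS : MeasurableSet S) {f g : X → ℝ} {b : ℝ} (hb : 0 ≤ b)
    (hfg : ∀ᵐ z ∂μ, z ∈ S → |f z| ≤ g z)
    (hg : ∫⁻ z in S, ENNReal.ofReal (g z) ∂μ ≤ ENNReal.ofReal b) :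
    |∫ z in S, f z ∂μ| ≤ b := by
  have h1 := norm_integral_le_lintegral_norm (μ := μ.restrict S) f
  rw [Real.norm_eq_abs] at h1
  refine h1.trans (ENNReal.toReal_le_of_le_ofReal hb (le_trans ?_ hg))
  refine lintegral_mono_ae ?_
  filter_upwards [(ae_restrict_iff' hS).2 hfg] with z hz
  exact ENNReal.ofReal_le_ofReal hz

lemma lintegral_ofReal_const_mul_le {X : Type*} [MeasurableSpace X] {μ : Measure X}
    {g : X → ℝ} {k b : ℝ} (hk : 0 ≤ k)
    (hg : ∫⁻ z, ENNReal.ofReal (g z) ∂μ ≤ ENNReal.ofReal b) :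
    ∫⁻ z, ENNReal.ofReal (k * g z) ∂μ ≤ ENNReal.ofReal (k * b) := by
  simp_rw [ENNReal.ofReal_mul hk]
  rw [lintegral_const_mul' _ _ ENNReal.ofReal_ne_top]
  gcongr

section Levy

variable {N : ℕ} {σ : ℝ} {ν : RN N → Measure (RN N)} {C : ℝ → ℝ → ℝ} {R : ℝ} {y p : RN N}
  {δ : ℝ}

/-- If `σ < 1` there is no compensator and the integrand is at most `(‖p‖ + H * δ) * ‖z‖`, so (M2)
with exponent `1` applies. If `σ ≥ 1`, then `δ < 1` lets the compensator cancel the linear part on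
the whole ball, and (M2) with exponent `2` applies to `H * ‖z‖ ^ 2`. The absolute values are there
because (M2) says nothing about `C R 1` when `σ ≥ 1`. -/
lemma abs_levyOp_paraboloid_le (hσ : σ < 2) (hν : CondM2 σ ν C) (hR : 0 < R)
    (hy : y ∈ closedBall 0 R) {H : ℝ} (hH : 0 ≤ H) (hδ : δ ∈ Ioo (0 : ℝ) 1) :
    |levyOp σ ν y (ball 0 δ) (fun x => inner ℝ p (x - y) + H * ‖x - y‖ ^ 2) y p| ≤
      (|C R 1| + |C R 2|) * (‖p‖ + H * δ) * δ ^ (1 - σ) := by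
  have hδ1 := Real.rpow_pos_of_pos hδ.1 (1 - σ)
  have hpH : 0 ≤ ‖p‖ + H * δ := add_nonneg (norm_nonneg p) (mul_nonneg hH hδ.1.le)
  unfold levyOp
  rcases lt_or_ge σ 1 with h | h
  · obtain ⟨hC, hν⟩ := hν R hR 1 ⟨h, by norm_num⟩
    have h1 : |∫ z in ball 0 δ, levyIntegrand σ
        (fun x => inner ℝ p (x - y) + H * ‖x - y‖ ^ 2) y p z ∂(ν y)| ≤
        (‖p‖ + H * δ) * (C R 1 * δ ^ (1 - σ)) := by
      refine abs_setIntegral_le_of_lintegral_le measurableSet_ball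
        (g := fun z => (‖p‖ + H * δ) * ‖z‖ ^ (1 : ℝ)) (by positivity) ?_
        (lintegral_ofReal_const_mul_le hpH (hν δ hδ y hy))
      refine Filter.Eventually.of_forall fun z hz => ?_
      rw [mem_ball_zero_iff] at hz
      have hz0 := norm_nonneg z
      have h2 := abs_real_inner_le_norm p z
      simp only [levyIntegrand, h, if_true, add_sub_cancel_left, sub_self, inner_zero_right,
        norm_zero, sub_zero, Real.rpow_one]
      have h3 : H * ‖z‖ ^ 2 ≤ H * δ * ‖z‖ := by
        rw [mul_assoc, pow_two]; gcongr
      have h4 : 0 ≤ H * ‖z‖ ^ 2 := by positivity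
      rw [abs_le] at h2
      norm_num
      rw [abs_le]; constructor <;> nlinarith
    refine h1.trans ?_
    have := le_abs_self (C R 1)
    have := abs_nonneg (C R 2)
    calc _ = C R 1 * (‖p‖ + H * δ) * δ ^ (1 - σ) := by ring
      _ ≤ _ := by gcongr; linarith
  · obtain ⟨hC, hν⟩ := hν R hR 2 ⟨hσ, le_rfl⟩
    have h1 : |∫ z in ball 0 δ, levyIntegrand σ
        (fun x => inner ℝ p (x - y) + H * ‖x - y‖ ^ 2) y p z ∂(ν y)| ≤
        H * (C R 2 * δ ^ (2 - σ)) := by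
      have := Real.rpow_pos_of_pos hδ.1 (2 - σ)
      refine abs_setIntegral_le_of_lintegral_le measurableSet_ball
        (g := fun z => H * ‖z‖ ^ (2 : ℝ)) (by positivity) ?_
        (lintegral_ofReal_const_mul_le hH (hν δ hδ y hy))
      refine Filter.Eventually.of_forall fun z hz => ?_
      have hz1 : z ∈ ball (0 : RN N) 1 := ball_subset_ball hδ.2.le hz
      have h4 : 0 ≤ H * ‖z‖ ^ 2 := by positivity
      simp only [levyIntegrand, not_lt.2 h, if_false, indicator_of_mem hz1, add_sub_cancel_left,
        sub_self, inner_zero_right, norm_zero, Real.rpow_two]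
      norm_num
      rw [abs_of_nonneg hH]
    refine h1.trans ?_
    have e : δ ^ (2 - σ) = δ * δ ^ (1 - σ) := by
      rw [mul_comm, ← Real.rpow_add_one hδ.1.ne']; ring_nf
    have := le_abs_self (C R 2)
    have := abs_nonneg (C R 1)
    have := norm_nonneg p
    have := mul_nonneg hH hδ.1.le
    calc _ = C R 2 * (H * δ) * δ ^ (1 - σ) := by rw [e]; ring
      _ ≤ _ := by gcongr <;> linarith

/-- The increment of `u` is paired with (M1) at exponent `0`. The compensator lives on the unit
ball, where `‖z‖ ≤ ‖z‖ ^ α` because `α ≤ 1`; `α < σ` selects the pure power in `hFun` and avoids the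
logarithm. -/
lemma abs_levyOp_compl_le (hσ : 0 < σ) (hν : CondM1 σ ν C) (hR : 0 < R)
    (hy : y ∈ closedBall 0 R) (hδ : 0 < δ) {α : ℝ} (hα : α ∈ Ioc (0 : ℝ) 1) (hασ : α < σ)
    {u : RN N → ℝ} {M : ℝ} (hM : 0 ≤ M) (hu : ∀ᵐ z ∂(ν y), |u (y + z) - u y| ≤ M) :
    |levyOp σ ν y (ball 0 δ)ᶜ u y p| ≤
      M * (C R 0 * δ ^ (-σ)) + ‖p‖ * (C R α * δ ^ (α - σ)) := by
  obtain ⟨hC0, h0⟩ := hν R hR 0 (by norm_num)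
  obtain ⟨hCα, hα'⟩ := hν R hR α ⟨hα.1.le, hα.2.trans (by norm_num)⟩
  have h0 := h0 δ hδ y hy
  have hα' := hα' δ hδ y hy
  simp only [hFun, hσ, hασ, if_true, zero_sub] at h0 hα'
  have hp1 := Real.rpow_pos_of_pos hδ (-σ)
  have hp2 := Real.rpow_pos_of_pos hδ (α - σ)
  have hp := norm_nonneg p
  unfold levyOp
  refine abs_setIntegral_le_of_lintegral_le measurableSet_ball.compl
    (g := fun z => M * min 1 (‖z‖ ^ (0 : ℝ)) + ‖p‖ * min 1 (‖z‖ ^ α)) (by positivity) ?_ ?_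
  · filter_upwards [hu] with z hz _
    have hz0 := norm_nonneg z
    simp only [levyIntegrand, Real.rpow_zero, min_self, mul_one]
    have h1 : |(if σ < 1 then 0 else (ball (0 : RN N) 1).indicator (fun z => inner ℝ p z) z)| ≤
        ‖p‖ * min 1 (‖z‖ ^ α) := by
      have h2 : 0 ≤ ‖p‖ * min 1 (‖z‖ ^ α) :=
        mul_nonneg hp (le_min zero_le_one (Real.rpow_nonneg hz0 α))
      split_ifs
      · simpa using h2
      · by_cases hz1 : z ∈ ball (0 : RN N) 1
        · rw [indicator_of_mem hz1]
          rw [mem_ball_zero_iff] at hz1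
          refine (abs_real_inner_le_norm p z).trans ?_
          gcongr
          refine le_min hz1.le ?_
          rcases hz0.eq_or_lt with h | h
          · rw [← h]; exact Real.rpow_nonneg le_rfl α
          · simpa using Real.rpow_le_rpow_of_exponent_ge h hz1.le hα.2
        · rw [indicator_of_notMem hz1]; simpa using h2
    exact (abs_sub _ _).trans (add_le_add hz h1)
  · have hm : Measurable fun z : RN N => ENNReal.ofReal (M * min 1 (‖z‖ ^ (0 : ℝ))) := by fun_prop
    calc _ ≤ ∫⁻ z in (ball (0 : RN N) δ)ᶜ, (ENNReal.ofReal (M * min 1 (‖z‖ ^ (0 : ℝ))) +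
          ENNReal.ofReal (‖p‖ * min 1 (‖z‖ ^ α))) ∂(ν y) :=
            lintegral_mono fun z => ENNReal.ofReal_add_le
      _ ≤ _ := by
        rw [lintegral_add_left hm, ENNReal.ofReal_add (by positivity) (by positivity)]
        exact add_le_add (lintegral_ofReal_const_mul_le hM h0)
          (lintegral_ofReal_const_mul_le hp hα')

end Levy

/-! ### From local to uniform Hölder estimates. -/

/-- `u` is Hölder continuous in every ball contained in `Ω`, near its centre. -/
def LocalHolder {E : Type*} [NormedAddCommGroup E] (C γ : ℝ) (u : E → ℝ) (Ω : Set E) : Prop :=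
  ∀ x : E, ∀ ρ : ℝ, ball x ρ ⊆ Ω → ∀ y : E, ‖y - x‖ ≤ ρ / 4 → |u y - u x| ≤ C * ‖y - x‖ ^ γ

section

variable {E : Type*} [NormedAddCommGroup E] [NormedSpace ℝ E] {C γ : ℝ} {u : E → ℝ} {Ω : Set E}

/-- A local Hölder estimate propagates to the vertex of a cone contained in `Ω`. -/
lemma LocalHolder.abs_sub_le_of_cone (hu : LocalHolder C γ u Ω) (hC : 0 ≤ C) (hγ : 0 < γ)
    (hΩ : IsOpen Ω) {Λ : ℝ} (hΛ : 1 ≤ Λ) {x e : E} {ρ : ℝ} (hx : x ∈ Ω) (hρ : 0 ≤ ρ)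
    (he : ‖e‖ ≤ Λ * ρ) (hcone : ∀ s ∈ Ioc (0 : ℝ) 1, ball (x + s • e) (s * ρ) ⊆ Ω) :
    |u (x + e) - u x| ≤ C / (1 - (1 - 1 / (4 * Λ)) ^ γ) * ρ ^ γ := by
  -- With this ratio, consecutive points `x + (q ^ k) • e` are within a quarter of the radius of the
  -- cone's ball at the earlier one, so the increments form a geometric series of ratio `q ^ γ`.
  obtain ⟨q, hq⟩ : ∃ q, q = 1 - 1 / (4 * Λ) := ⟨_, rfl⟩
  have hq4 : 1 / (4 * Λ) ≤ 1 / 4 := by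
    apply one_div_le_one_div_of_le <;> linarith
  have hqp : 0 < 1 / (4 * Λ) := by positivity
  have hq0 : 0 < q := by linarith
  have hq1 : q < 1 := by linarith
  rw [← hq]
  have hqγ : q ^ γ < 1 := Real.rpow_lt_one hq0.le hq1 hγ
  have hstep : ∀ s ∈ Ioc (0 : ℝ) 1, |u (x + (q * s) • e) - u (x + s • e)| ≤ C * (s * ρ) ^ γ := by
    intro s hs
    have h1 : ‖x + (q * s) • e - (x + s • e)‖ = (1 - q) * s * ‖e‖ := by
      have : x + (q * s) • e - (x + s • e) = -(((1 - q) * s) • e) := by module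
      rw [this, norm_neg, norm_smul, Real.norm_of_nonneg (mul_nonneg (by linarith) hs.1.le)]
    have h2 : (1 - q) * s * ‖e‖ ≤ s * ρ / 4 := by
      have : (1 - q) * (Λ * ρ) = ρ / 4 := by rw [hq]; field_simp; ring
      calc (1 - q) * s * ‖e‖ = s * ((1 - q) * ‖e‖) := by ring
        _ ≤ s * ((1 - q) * (Λ * ρ)) := by
          have : 0 ≤ 1 - q := by linarith
          have := hs.1.le
          gcongr
        _ = _ := by rw [this]; ring
    have h3 := hu _ _ (hcone s hs) (x + (q * s) • e) (by rw [h1]; exact h2)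
    refine h3.trans ?_
    have : 0 ≤ s * ρ := mul_nonneg hs.1.le hρ
    gcongr
    rw [h1]; linarith
  have hchain : ∀ k : ℕ, ∀ s ∈ Ioc (0 : ℝ) 1,
      |u (x + (q ^ k * s) • e) - u (x + s • e)| ≤ C / (1 - q ^ γ) * (s * ρ) ^ γ := by
    intro k
    induction k with
    | zero =>
      intro s hs
      have : 0 ≤ C / (1 - q ^ γ) := div_nonneg hC (by linarith)
      have : 0 ≤ (s * ρ) ^ γ := Real.rpow_nonneg (mul_nonneg hs.1.le hρ) _
      simp only [pow_zero, one_mul, sub_self, abs_zero]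
      positivity
    | succ k ih =>
      intro s hs
      have h1 := ih (q * s) ⟨mul_pos hq0 hs.1, by nlinarith [hs.1, hs.2]⟩
      have h2 := hstep s hs
      have e1 : q ^ (k + 1) * s = q ^ k * (q * s) := by ring
      rw [mul_assoc q s ρ, Real.mul_rpow hq0.le (mul_nonneg hs.1.le hρ)] at h1
      rw [e1]
      refine (abs_sub_le _ (u (x + (q * s) • e)) _).trans ((add_le_add h1 h2).trans (le_of_eq ?_))
      have : 1 - q ^ γ ≠ 0 := by linarith
      field_simp
      ring
  -- The last link, from `x + q ^ k • e` to `x`, uses some ball around `x` of uncontrolled radius;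
  -- its contribution vanishes as `k` grows.
  obtain ⟨r, hr, hrΩ⟩ := Metric.isOpen_iff.1 hΩ x hx
  have hlim0 : Filter.Tendsto (fun k : ℕ => q ^ k * ‖e‖) Filter.atTop (nhds 0) := by
    simpa using (tendsto_pow_atTop_nhds_zero_of_lt_one hq0.le hq1).mul_const ‖e‖
  have hlim : Filter.Tendsto (fun k : ℕ => C / (1 - q ^ γ) * ρ ^ γ + C * (q ^ k * ‖e‖) ^ γ)
      Filter.atTop (nhds (C / (1 - q ^ γ) * ρ ^ γ)) := by
    have h := (hlim0.rpow_const (p := γ) (Or.inr hγ.le)).const_mul C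
    rw [Real.zero_rpow hγ.ne', mul_zero] at h
    simpa using h.const_add (C / (1 - q ^ γ) * ρ ^ γ)
  refine ge_of_tendsto hlim ?_
  filter_upwards [hlim0.eventually (gt_mem_nhds (show 0 < r / 4 by linarith))] with k hk
  have e1 : ‖x + q ^ k • e - x‖ = q ^ k * ‖e‖ := by
    rw [add_sub_cancel_left, norm_smul, Real.norm_of_nonneg (by positivity)]
  have h1 := hu x r hrΩ (x + q ^ k • e) (by rw [e1]; exact hk.le)
  have h2 := hchain k 1 (by norm_num)
  rw [e1] at h1
  rw [mul_one, one_smul, one_mul] at h2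
  rw [abs_sub_comm] at h2
  exact (abs_sub_le _ _ _).trans (add_le_add h2 h1)

/-- Go from `x` to `x + e` and from `y` to `y + f` along the cones; the two far ends are joined by
the local estimate in the ball of radius `ρ` around `y + f`. -/
lemma LocalHolder.abs_sub_le_of_cones (hu : LocalHolder C γ u Ω) (hC : 0 ≤ C) (hγ : 0 < γ)
    (hΩ : IsOpen Ω) {Λ : ℝ} (hΛ : 1 ≤ Λ) {x y e f : E} {ρ b : ℝ} (hx : x ∈ Ω) (hy : y ∈ Ω)
    (hρ : 0 ≤ ρ) (hb : 0 ≤ b) (hρb : ρ ≤ b * ‖x - y‖) (he : ‖e‖ ≤ Λ * ρ) (hf : ‖f‖ ≤ Λ * ρ)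
    (hxe : ∀ s ∈ Ioc (0 : ℝ) 1, ball (x + s • e) (s * ρ) ⊆ Ω)
    (hyf : ∀ s ∈ Ioc (0 : ℝ) 1, ball (y + s • f) (s * ρ) ⊆ Ω)
    (h1 : ‖x + e - (y + f)‖ ≤ ρ / 4) (h2 : ‖x + e - (y + f)‖ ≤ ‖x - y‖) :
    |u x - u y| ≤ (2 * (C / (1 - (1 - 1 / (4 * Λ)) ^ γ)) * b ^ γ + C) * ‖x - y‖ ^ γ := by
  have hΛ' : 1 / (4 * Λ) ≤ 1 := by
    rw [div_le_one (by positivity)]; linarith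
  have hq : (1 - 1 / (4 * Λ)) ^ γ < 1 :=
    Real.rpow_lt_one (by linarith) (by have : 0 < 1 / (4 * Λ) := by positivity
                                       linarith) hγ
  obtain ⟨D, hD⟩ : ∃ D, D = C / (1 - (1 - 1 / (4 * Λ)) ^ γ) := ⟨_, rfl⟩
  have hD0 : 0 ≤ D := hD ▸ div_nonneg hC (by linarith)
  have hX := hu.abs_sub_le_of_cone hC hγ hΩ hΛ hx hρ he hxe
  have hY := hu.abs_sub_le_of_cone hC hγ hΩ hΛ hy hρ hf hyf
  have hXY := hu (y + f) ρ (by simpa using hyf 1 (by norm_num)) (x + e) h1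
  rw [← hD] at hX hY ⊢
  have h3 : ρ ^ γ ≤ b ^ γ * ‖x - y‖ ^ γ := by
    rw [← Real.mul_rpow hb (norm_nonneg _)]; gcongr
  have h4 : D * ρ ^ γ ≤ D * (b ^ γ * ‖x - y‖ ^ γ) := by gcongr
  have h5 : C * ‖x + e - (y + f)‖ ^ γ ≤ C * ‖x - y‖ ^ γ := by gcongr
  rw [abs_le] at *
  constructor <;> linarith [hX.1, hX.2, hY.1, hY.2, hXY.1, hXY.2]

lemma LocalHolder.exists_bound_on_balls (hC : 0 ≤ C) (hγ : 0 < γ) (hΩ : IsOpen Ω) :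
    ∃ K : ℝ, 0 ≤ K ∧ ∀ u : E → ℝ, LocalHolder C γ u Ω → ∀ x₀ : E, ∀ r : ℝ, ball x₀ r ⊆ Ω →
      ∀ x ∈ ball x₀ r, ∀ y ∈ ball x₀ r, |u x - u y| ≤ K * ‖x - y‖ ^ γ := by
  have hq : (1 - 1 / (4 * 1) : ℝ) ^ γ < 1 := Real.rpow_lt_one (by norm_num) (by norm_num) hγ
  refine ⟨2 * (C / (1 - (1 - 1 / (4 * 1)) ^ γ)) * 4 ^ γ + C, ?_, ?_⟩
  · have := div_nonneg hC (sub_nonneg.2 hq.le)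
    positivity
  intro u hu x₀ r hr x hx y hy
  have hr0 : 0 < r := pos_of_mem_ball hx
  have ht := norm_nonneg (x - y)
  -- The cones come from contracting towards `x₀` by the fraction `μ`. If `μ = 1` their far ends
  -- meet at `x₀`; otherwise the radius `μ * r` is `4 * ‖x - y‖`, as the middle link requires.
  obtain ⟨μ, hμ⟩ : ∃ μ, μ = min 1 (4 * ‖x - y‖ / r) := ⟨_, rfl⟩
  have hμ0 : 0 ≤ μ := hμ ▸ le_min zero_le_one (by positivity)
  have hμ1 : μ ≤ 1 := hμ ▸ min_le_left _ _
  have hμr : μ * r ≤ 4 * ‖x - y‖ := by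
    rw [← le_div_iff₀ hr0]; exact hμ ▸ min_le_right _ _
  have hcone : ∀ z ∈ ball x₀ r, ∀ s ∈ Ioc (0 : ℝ) 1,
      ball (z + s • (μ • (x₀ - z))) (s * (μ * r)) ⊆ Ω := by
    intro z hz s hs
    refine (ball_subset_ball' ?_).trans hr
    rw [mem_ball, dist_eq_norm] at hz
    have hs1 : s * μ ≤ 1 := by nlinarith [hs.1, hs.2]
    have e1 : z + s • (μ • (x₀ - z)) - x₀ = (1 - s * μ) • (z - x₀) := by module
    rw [dist_eq_norm, e1, norm_smul, Real.norm_of_nonneg (by linarith)]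
    nlinarith
  have hnorm : ∀ z ∈ ball x₀ r, ‖μ • (x₀ - z)‖ ≤ 1 * (μ * r) := by
    intro z hz
    rw [mem_ball', dist_eq_norm] at hz
    rw [norm_smul, Real.norm_of_nonneg hμ0, one_mul]
    gcongr
  have e2 : x + μ • (x₀ - x) - (y + μ • (x₀ - y)) = (1 - μ) • (x - y) := by module
  have e3 : ‖x + μ • (x₀ - x) - (y + μ • (x₀ - y))‖ = (1 - μ) * ‖x - y‖ := by
    rw [e2, norm_smul, Real.norm_of_nonneg (by linarith)]
  refine hu.abs_sub_le_of_cones hC hγ hΩ le_rfl (hr hx) (hr hy) (mul_nonneg hμ0 hr0.le)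
    (by norm_num) hμr (hnorm x hx) (hnorm y hy) (hcone x hx) (hcone y hy) ?_ ?_
  · rw [e3]
    rcases min_choice 1 (4 * ‖x - y‖ / r) with h | h
    · rw [hμ, h]; simp only [sub_self, zero_mul, one_mul]; positivity
    · have h' : μ * r = 4 * ‖x - y‖ := by rw [hμ, h]; field_simp
      rw [h']; nlinarith
  · rw [e3]; nlinarith

/-- Near `p`, the set `Ω` contains with every point a truncated cone with a fixed axis. -/
def HasInteriorCones (Ω : Set E) (p : E) : Prop :=
  ∃ ε : ℝ, 0 < ε ∧ ∃ c : ℝ, 0 < c ∧ c ≤ 1 ∧ ∃ n : E, ‖n‖ ≤ 1 ∧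
    ∀ x ∈ Ω ∩ ball p ε, ∀ s ∈ Ioo (0 : ℝ) ε, ball (x + s • n) (c * s) ⊆ Ω

lemma hasInteriorCones_of_mem (hΩ : IsOpen Ω) {p : E} (hp : p ∈ Ω) : HasInteriorCones Ω p := by
  obtain ⟨r, hr, hrΩ⟩ := Metric.isOpen_iff.1 hΩ p hp
  refine ⟨r / 2, by positivity, 1, one_pos, le_rfl, 0, by simp, fun x hx s hs => ?_⟩
  refine (ball_subset_ball' ?_).trans hrΩ
  have := hx.2
  rw [mem_ball] at this
  rw [smul_zero, add_zero]
  linarith [hs.2]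

lemma HasInteriorCones.exists_bound_near {p : E} (hp : HasInteriorCones Ω p) (hC : 0 ≤ C)
    (hγ : 0 < γ) (hΩ : IsOpen Ω) :
    ∃ ε : ℝ, 0 < ε ∧ ∃ K : ℝ, ∀ u : E → ℝ, LocalHolder C γ u Ω →
      ∀ x ∈ Ω ∩ ball p ε, ∀ y ∈ Ω ∩ ball p ε, |u x - u y| ≤ K * ‖x - y‖ ^ γ := by
  obtain ⟨ε, hε, c, hc, hc1, n, hn, hcone⟩ := hp
  -- The common axis keeps the far ends at distance `‖x - y‖`. The height `τ` is chosen so that `c *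
  -- τ = 4 * ‖x - y‖`, and the radius `c * ε / 8` forces `τ < ε`.
  refine ⟨c * ε / 8, by positivity, 2 * (C / (1 - (1 - 1 / (4 * (1 / c))) ^ γ)) * 4 ^ γ + C,
    fun u hu x hx y hy => ?_⟩
  have hce : c * ε / 8 ≤ ε := by nlinarith
  have hx1 := hx.2
  have hy1 := hy.2
  rw [mem_ball] at hx1 hy1
  rcases eq_or_ne x y with rfl | hxy
  · simp [Real.zero_rpow hγ.ne']
  have ht : 0 < ‖x - y‖ := norm_pos_iff.2 (sub_ne_zero.2 hxy)
  have ht2 : ‖x - y‖ < c * ε / 4 := by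
    rw [← dist_eq_norm]
    have := dist_triangle_right x y p
    linarith
  obtain ⟨τ, hτ⟩ : ∃ τ, τ = 4 * ‖x - y‖ / c := ⟨_, rfl⟩
  have hτ0 : 0 < τ := hτ ▸ by positivity
  have hτc : c * τ = 4 * ‖x - y‖ := by rw [hτ]; field_simp
  have hτε : τ < ε := by rw [hτ, div_lt_iff₀ hc]; linarith
  have hnorm : ‖τ • n‖ ≤ 1 / c * (4 * ‖x - y‖) := by
    rw [norm_smul, Real.norm_of_nonneg hτ0.le, ← hτc]
    field_simp
    nlinarith
  have hcone' : ∀ z ∈ Ω ∩ ball p (c * ε / 8), ∀ s ∈ Ioc (0 : ℝ) 1,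
      ball (z + s • (τ • n)) (s * (4 * ‖x - y‖)) ⊆ Ω := by
    intro z hz s hs
    have h := hcone z ⟨hz.1, ball_subset_ball hce hz.2⟩ (s * τ)
      ⟨mul_pos hs.1 hτ0, by nlinarith [hs.1, hs.2]⟩
    have e : c * (s * τ) = s * (4 * ‖x - y‖) := by rw [← hτc]; ring
    rwa [e, mul_smul] at h
  have e2 : ‖x + τ • n - (y + τ • n)‖ = ‖x - y‖ := by rw [add_sub_add_right_eq_sub]
  exact hu.abs_sub_le_of_cones hC hγ hΩ (by rw [le_div_iff₀ hc]; linarith) hx.1 hy.1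
    (by positivity) (by norm_num) le_rfl hnorm hnorm (hcone' x hx) (hcone' y hy)
    (by rw [e2]; linarith) e2.le

/-- Uniform Hölder estimates in a relatively compact set with interior cones. -/
lemma LocalHolder.exists_bound_of_hasInteriorCones (hC : 0 ≤ C) (hγ : 0 < γ) (hΩ : IsOpen Ω)
    (hcpt : IsCompact (closure Ω)) (hcone : ∀ p ∈ closure Ω, HasInteriorCones Ω p) {M : ℝ}
    (hM : 0 ≤ M) :
    ∃ K : ℝ, 0 ≤ K ∧ ∀ u : E → ℝ, LocalHolder C γ u Ω →
      (∀ x ∈ Ω, ∀ y ∈ Ω, |u x - u y| ≤ M) →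
      ∀ x ∈ Ω, ∀ y ∈ Ω, |u x - u y| ≤ K * ‖x - y‖ ^ γ := by
  -- Compactness induction: only `x` is localized, while `y` ranges over all points of `Ω` close to
  -- it, so the bounds for two sets combine by a minimum and a maximum.
  have key : ∃ ε : ℝ, 0 < ε ∧ ∃ K : ℝ, ∀ u : E → ℝ, LocalHolder C γ u Ω →
      ∀ x ∈ closure Ω, x ∈ Ω → ∀ y ∈ Ω, ‖x - y‖ < ε → |u x - u y| ≤ K * ‖x - y‖ ^ γ := by
    refine hcpt.induction_on (p := fun S => ∃ ε : ℝ, 0 < ε ∧ ∃ K : ℝ, ∀ u : E → ℝ,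
      LocalHolder C γ u Ω → ∀ x ∈ S, x ∈ Ω → ∀ y ∈ Ω, ‖x - y‖ < ε →
      |u x - u y| ≤ K * ‖x - y‖ ^ γ) ⟨1, one_pos, 0, by simp⟩ ?_ ?_ ?_
    · rintro S T hST ⟨ε, hε, K, h⟩
      exact ⟨ε, hε, K, fun u hu x hx => h u hu x (hST hx)⟩
    · rintro S T ⟨ε, hε, K, h⟩ ⟨ε', hε', K', h'⟩
      refine ⟨min ε ε', lt_min hε hε', max K K', ?_⟩
      rintro u hu x (hx | hx) hxΩ y hy hxy
      · refine (h u hu x hx hxΩ y hy (hxy.trans_le (min_le_left _ _))).trans ?_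
        gcongr; exact le_max_left _ _
      · refine (h' u hu x hx hxΩ y hy (hxy.trans_le (min_le_right _ _))).trans ?_
        gcongr; exact le_max_right _ _
    · intro p hp
      obtain ⟨ε, hε, K, h⟩ := (hcone p hp).exists_bound_near hC hγ hΩ
      refine ⟨ball p (ε / 2), mem_nhdsWithin_of_mem_nhds (ball_mem_nhds p (by positivity)),
        ε / 2, by positivity, K, fun u hu x hx hxΩ y hy hxy => ?_⟩
      refine h u hu x ⟨hxΩ, ball_subset_ball (by linarith) hx⟩ y ⟨hy, ?_⟩
      rw [mem_ball] at hx ⊢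
      rw [← dist_eq_norm, dist_comm] at hxy
      linarith [dist_triangle y x p]
  obtain ⟨ε, hε, K, h⟩ := key
  refine ⟨max K (M / ε ^ γ), le_max_of_le_right (by positivity), fun u hu hM' x hx y hy => ?_⟩
  rcases lt_or_ge ‖x - y‖ ε with hxy | hxy
  · refine (h u hu x (subset_closure hx) hx y hy hxy).trans ?_
    gcongr; exact le_max_left _ _
  · calc |u x - u y| ≤ M := hM' x hx y hy
      _ = M / ε ^ γ * ε ^ γ := by
        have := (Real.rpow_pos_of_pos hε γ).ne'
        field_simp
      _ ≤ _ := by gcongr; exact le_max_right _ _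

end

/-! ### Extension of Hölder functions. -/

/-- The McShane extension of a Hölder continuous function. -/
lemma exists_holder_extension {E : Type*} [NormedAddCommGroup E] {K γ : ℝ} (hK : 0 ≤ K)
    (hγ : 0 < γ) (hγ1 : γ ≤ 1) {S : Set E} (hS : S.Nonempty) {u : E → ℝ}
    (hu : ∀ x ∈ S, ∀ y ∈ S, |u x - u y| ≤ K * ‖x - y‖ ^ γ) :
    ∃ v : E → ℝ, EqOn v u S ∧ ∀ x y, |v x - v y| ≤ K * ‖x - y‖ ^ γ := by
  have := hS.to_subtype
  obtain ⟨s₀, hs₀⟩ := hS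
  -- As `γ ≤ 1`, the modulus `K * ‖a - b‖ ^ γ` obeys the triangle inequality, so the Lipschitz
  -- extension formula applies.
  have htri : ∀ a b c : E, K * ‖a - c‖ ^ γ ≤ K * ‖a - b‖ ^ γ + K * ‖b - c‖ ^ γ := by
    intro a b c
    rw [← mul_add]
    gcongr
    refine le_trans ?_ (Real.rpow_add_le_add_rpow (norm_nonneg _) (norm_nonneg _) hγ.le hγ1)
    gcongr
    exact norm_sub_le_norm_sub_add_norm_sub a b c
  have hbdd : ∀ x, BddBelow (range fun s : S => u s + K * ‖x - (s : E)‖ ^ γ) := by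
    intro x
    refine ⟨u s₀ - K * ‖x - s₀‖ ^ γ, ?_⟩
    rintro _ ⟨s, rfl⟩
    have h1 := (abs_le.1 (hu s₀ hs₀ s s.2)).2
    have h2 := htri s₀ x s
    rw [norm_sub_rev s₀ x] at h2
    simp only
    linarith
  have hle : ∀ x y, (⨅ s : S, u s + K * ‖x - (s : E)‖ ^ γ) ≤
      (⨅ s : S, u s + K * ‖y - (s : E)‖ ^ γ) + K * ‖x - y‖ ^ γ := by
    intro x y
    rw [← sub_le_iff_le_add]
    refine le_ciInf fun s => ?_
    have h1 := ciInf_le (hbdd x) s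
    have h2 := htri x y s
    linarith
  refine ⟨fun x => ⨅ s : S, u s + K * ‖x - (s : E)‖ ^ γ, fun x hx => le_antisymm ?_ ?_, fun x y => ?_⟩
  · refine (ciInf_le (hbdd x) ⟨x, hx⟩).trans ?_
    simp [Real.zero_rpow hγ.ne']
  · refine le_ciInf fun s => ?_
    have := (abs_le.1 (hu x hx s s.2)).2
    linarith
  · have h1 := hle x y
    have h2 := hle y x
    rw [norm_sub_rev y x] at h2
    rw [abs_le]; constructor <;> linarith

/-! ### The exponent and the test paraboloids. -/

lemma holderExp_pos {m σ θ : ℝ} (hm : 0 < m) (hσ : σ < m) (hθ : θ < m) : 0 < holderExp m σ θ :=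
  lt_min (div_pos (sub_pos.2 hσ) hm) (div_pos (sub_pos.2 hθ) hm)

lemma holderExp_mul_le_left {m σ θ : ℝ} (hm : 0 < m) : holderExp m σ θ * m ≤ m - σ :=
  (le_div_iff₀ hm).1 (min_le_left _ _)

lemma holderExp_mul_le_right {m σ θ : ℝ} (hm : 0 < m) : holderExp m σ θ * m ≤ m - θ :=
  (le_div_iff₀ hm).1 (min_le_right _ _)

lemma hasGradientAt_paraboloid {E : Type*} [NormedAddCommGroup E] [InnerProductSpace ℝ E]
    [CompleteSpace E] (p y : E) (H : ℝ) :
    HasGradientAt (fun x => inner ℝ p (x - y) + H * ‖x - y‖ ^ 2) p y := by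
  rw [hasGradientAt_iff_hasFDerivAt]
  have h0 : HasFDerivAt (fun x : E => x - y) (ContinuousLinearMap.id ℝ E) y :=
    (hasFDerivAt_id y).sub_const y
  have h1 : HasFDerivAt (fun x => inner ℝ p (x - y)) (innerSL ℝ p) y :=
    (innerSL ℝ p).hasFDerivAt.comp y h0
  have h2 := (h0.norm_sq).const_mul H
  refine (h1.add h2).congr_fderiv ?_
  ext z
  simp

lemma contDiff_paraboloid {E : Type*} [NormedAddCommGroup E] [InnerProductSpace ℝ E]
    (p y : E) (H : ℝ) : ContDiff ℝ 2 (fun x => inner ℝ p (x - y) + H * ‖x - y‖ ^ 2) := by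
  refine ContDiff.add (contDiff_const.inner ℝ (contDiff_id.sub contDiff_const))
    (contDiff_const.mul ((contDiff_id.sub contDiff_const).norm_sq ℝ))

/-! ### Geometry of the domain. -/

section Domain

variable {N : ℕ} {Ω : Set (RN N)}

/-- Positive dimension and boundedness make the frontier nonempty; otherwise `infDist` would take
its default value `0`. -/
lemma le_bdryDist (hN : 0 < N) (hΩb : Bornology.IsBounded Ω) {x : RN N} {δ : ℝ} (hδ : 0 < δ)
    (h : ball x δ ⊆ Ω) (hΩ : IsOpen Ω) : δ ≤ bdryDist Ω x := by
  have : Nonempty (Fin N) := ⟨⟨0, hN⟩⟩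
  have hne : (frontier Ω).Nonempty := by
    rw [nonempty_frontier_iff]
    refine ⟨⟨x, h (mem_ball_self hδ)⟩, fun h' => ?_⟩
    exact NormedSpace.unbounded_univ ℝ (RN N) (h' ▸ hΩb)
  refine (le_infDist hne).2 fun z hz => ?_
  by_contra! hlt
  rw [hΩ.frontier_eq] at hz
  exact hz.2 (h (by rwa [mem_ball, dist_comm]))

/-- Only the local Lipschitz constant `K` of `g` matters. Moving by `s • n` raises the height by `s`
and leaves the projection fixed; a further displacement shorter than `c * s` costs at most `c * s`
in height and `2 * K * c * s` in `g`, less than `s` in total for `c = 1 / (2 * K + 2)`. -/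
lemma HasC11Boundary.hasInteriorCones (hΩ : IsOpen Ω) (h : HasC11Boundary Ω) {p : RN N}
    (hp : p ∈ closure Ω) : HasInteriorCones Ω p := by
  by_cases hpΩ : p ∈ Ω
  · exact hasInteriorCones_of_mem hΩ hpΩ
  obtain ⟨r, hr, n, hn, g, hg, -, hΩg⟩ := h p (hΩ.frontier_eq ▸ ⟨hp, hpΩ⟩)
  obtain ⟨K, t, ht, hK⟩ :=
    (hg.contDiffAt (x := p - (inner ℝ n p : ℝ) • n)).exists_lipschitzOnWith
  have hcont : ContinuousAt (fun x : RN N => x - (inner ℝ n x : ℝ) • n) p := by fun_prop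
  obtain ⟨r', hr', ht'⟩ := Metric.mem_nhds_iff.1 (hcont ht)
  -- Points of the cones lie within `ε + 2 * s < 3 * ε` of `p`, inside both the chart and the ball
  -- where `g` is Lipschitz.
  obtain ⟨ε, hε⟩ : ∃ ε, ε = min r r' / 3 := ⟨_, rfl⟩
  have hε0 : 0 < ε := hε ▸ div_pos (lt_min hr hr') (by norm_num)
  have hεr : 3 * ε ≤ r := by linarith [min_le_left r r']
  have hεr' : 3 * ε ≤ r' := by linarith [min_le_right r r']
  have hK0 : (0 : ℝ) ≤ K := K.2
  obtain ⟨c, hc⟩ : ∃ c : ℝ, c = 1 / (2 * K + 2) := ⟨_, rfl⟩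
  have hc0 : 0 < c := hc ▸ by positivity
  have hcK : c * (2 * K + 2) = 1 := by rw [hc]; field_simp
  have hc1 : c ≤ 1 := by nlinarith
  refine ⟨ε, hε0, c, hc0, hc1, n, hn.le, fun x hx s hs y hy => ?_⟩
  have hxp := mem_ball.1 hx.2
  have hyx : ‖y - (x + s • n)‖ < c * s := by rwa [mem_ball, dist_eq_norm] at hy
  have hcs : c * s ≤ s := by nlinarith [hs.1]
  have hyp : dist y p < 3 * ε := by
    have h1 : dist y x < 2 * s := by
      rw [dist_eq_norm]
      have e : y - x = (y - (x + s • n)) + s • n := by abel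
      rw [e]
      refine (norm_add_le _ _).trans_lt ?_
      rw [norm_smul, hn, Real.norm_of_nonneg hs.1.le]
      linarith
    linarith [dist_triangle y x p, hs.2]
  have hxt := ht' (mem_ball.2 (by linarith : dist x p < r'))
  have hyt := ht' (mem_ball.2 (by linarith : dist y p < r'))
  have hLip := hK.dist_le_mul _ hyt _ hxt
  have hgx := (hΩg x (mem_ball.2 (by linarith))).1 hx.1
  refine (hΩg y (mem_ball.2 (by linarith))).2 ?_
  obtain ⟨w, hw⟩ : ∃ w, w = y - (x + s • n) := ⟨_, rfl⟩
  have hwn : ‖w‖ < c * s := hw ▸ hyx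
  have hyw : y = x + s • n + w := by rw [hw]; abel
  have hin : inner ℝ n y = inner ℝ n x + s + inner ℝ n w := by
    rw [hyw, inner_add_right, inner_add_right, inner_smul_right, real_inner_self_eq_norm_sq, hn]
    ring
  have hwi : |inner ℝ n w| ≤ ‖w‖ := by
    simpa [hn] using abs_real_inner_le_norm n w
  have hproj : dist (y - (inner ℝ n y : ℝ) • n) (x - (inner ℝ n x : ℝ) • n) ≤ 2 * (c * s) := by
    have e : y - (inner ℝ n y : ℝ) • n - (x - (inner ℝ n x : ℝ) • n) =
        w - (inner ℝ n w : ℝ) • n := by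
      rw [hin, hyw]; module
    rw [dist_eq_norm, e]
    refine (norm_sub_le _ _).trans ?_
    rw [norm_smul, hn, Real.norm_eq_abs]
    linarith
  have hgd := (abs_le.1 ((Real.dist_eq _ _).symm.le.trans
    (hLip.trans (mul_le_mul_of_nonneg_left hproj hK0)))).2
  have hw' := (abs_le.1 hwi).1
  have e : K * (2 * (c * s)) + c * s < s := by
    have : s = c * (2 * K + 2) * s := by rw [hcK, one_mul]
    have : 0 < c * s := mul_pos hc0 hs.1
    linarith
  simp only at hgd
  linarith

end Domain

/-! ### Steep paraboloids and comparison with the barrier. -/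

section Touching

variable {N : ℕ} {Ω : Set (RN N)} {A b₀ σ m θ : ℝ} {C₁ C₂ : ℝ → ℝ → ℝ} {M : ℝ}

/-- A subsolution is not touched from above by steep paraboloids. -/
lemma exists_no_steep_paraboloid (hN : 0 < N) (hΩo : IsOpen Ω) (hΩb : Bornology.IsBounded Ω)
    (hA : 0 < A) (hb₀ : 0 < b₀) (hσ : σ ∈ Ioo (0 : ℝ) 2) (hm : max 1 σ < m)
    (hθ : 0 ≤ θ) (hM : 0 ≤ M) {γ κ : ℝ} (hγσ : γ * m ≤ m - σ) (hγθ : γ * m ≤ m - θ)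
    (hκ : 0 ≤ κ) :
    ∃ T : ℝ, 1 ≤ T ∧ ∀ ν : RN N → Measure (RN N), CondM1 σ ν C₁ → CondM2 σ ν C₂ →
      ∀ u : RN N → ℝ, (∃ c : ℝ, ∀ x, |u x| ≤ c) →
        IsViscositySubsolution Ω σ ν b₀ m (fun x => A * (bdryDist Ω x ^ (-θ) + 1)) u →
        oscOn u (reachSet Ω ν) ≤ M →
      ∀ y : RN N, ∀ δ ∈ Ioo (0 : ℝ) 1, ball y δ ⊆ Ω → ∀ p : RN N, ∀ H : ℝ, 0 ≤ H →
        T * δ ^ (γ - 1) ≤ ‖p‖ → H * δ ≤ κ * ‖p‖ →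
        ¬ ∀ z ∈ ball y δ, u z ≤ u y + (inner ℝ p (z - y) + H * ‖z - y‖ ^ 2) := by
  have hm1 : 1 < m := (le_max_left _ _).trans_lt hm
  have hm0 : 0 < m := by linarith
  have hmσ : σ < m := (le_max_right _ _).trans_lt hm
  obtain ⟨R, hR, hΩR⟩ := hΩb.subset_closedBall_lt 0 (0 : RN N)
  obtain ⟨G, hG⟩ : ∃ G, G = 2 * A + M * |C₁ R 0| := ⟨_, rfl⟩
  obtain ⟨B, hB⟩ : ∃ B, B = (|C₂ R 1| + |C₂ R 2|) * (1 + κ) + |C₁ R (σ / m)| := ⟨_, rfl⟩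
  have hG0 : 0 ≤ G := hG ▸ by positivity
  have hB0 : 0 ≤ B := hB ▸ by positivity
  -- `G` collects the terms free of `p` and `B` those linear in it; `m > 1` makes the requirement on
  -- `T` attainable.
  obtain ⟨T, hT1, hT⟩ : ∃ T : ℝ, 1 ≤ T ∧ (G + B) / b₀ < T ^ (m - 1) :=
    ((Filter.eventually_ge_atTop 1).and
      ((tendsto_rpow_atTop (sub_pos.2 hm1)).eventually_gt_atTop _)).exists
  rw [div_lt_iff₀ hb₀] at hT
  refine ⟨T, hT1, fun ν h1 h2 u ⟨c, hc⟩ hu hosc y δ hδ hball p H hH hp hHδ htouch => ?_⟩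
  have hyΩ : y ∈ Ω := hball (mem_ball_self hδ.1)
  have hyR := hΩR hyΩ
  have hδ0 := hδ.1
  have hp0 := norm_nonneg p
  have hvisc := hu.2 y hyΩ _ (contDiff_paraboloid p y H) δ hδ.1 (fun z hz => by
    have := htouch z hz
    simp only [sub_self, inner_zero_right, norm_zero]
    norm_num
    linarith)
  rw [(hasGradientAt_paraboloid p y H).gradient] at hvisc
  have hin := (abs_le.1 (abs_levyOp_paraboloid_le (p := p) hσ.2 h2 hR hyR hH hδ)).2
  -- The exponent `σ / m` is below `σ` and at most `1`, and `σ / m - σ = -(σ / m) * (m - 1)` matches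
  -- `E ^ (m - 1)` since `γ - 1 ≤ -(σ / m)`.
  have hσm : σ / m ∈ Ioc (0 : ℝ) 1 := ⟨div_pos hσ.1 hm0, (div_le_one hm0).2 hmσ.le⟩
  have hout := (abs_le.1 (abs_levyOp_compl_le (p := p) hσ.1 h1 hR hyR hδ.1 hσm
    (div_lt_self hσ.1 hm1) hM (by
      filter_upwards [ae_add_mem_reachSet (ν := ν) hyΩ] with z hz
      exact (abs_sub_le_oscOn hc hz (subset_reachSet hyΩ)).trans hosc))).2
  obtain ⟨E, hE⟩ : ∃ E, E = δ ^ (γ - 1) := ⟨_, rfl⟩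
  have hE0 : 0 < E := hE ▸ Real.rpow_pos_of_pos hδ.1 _
  have hEpow : ∀ k : ℝ, E ^ k = δ ^ ((γ - 1) * k) := fun k => by
    rw [hE, Real.rpow_mul hδ.1.le]
  have hmono : ∀ {a b : ℝ}, a ≤ b → δ ^ b ≤ δ ^ a := fun h =>
    Real.rpow_le_rpow_of_exponent_ge hδ.1 hδ.2.le h
  have hbd : bdryDist Ω y ^ (-θ) ≤ E ^ m := by
    refine (Real.rpow_le_rpow_of_nonpos hδ.1 (le_bdryDist hN hΩb hδ.1 hball hΩo)
      (neg_nonpos.2 hθ)).trans ?_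
    rw [hEpow]; exact hmono (by linarith)
  have hE1 : 1 ≤ E ^ m := by
    rw [hEpow]; exact (Real.rpow_zero δ).symm.le.trans (hmono (by linarith [hσ.1]))
  have hEσ : δ ^ (-σ) ≤ E ^ m := by
    rw [hEpow]; exact hmono (by linarith)
  have hEs : δ ^ (σ / m - σ) ≤ E ^ (m - 1) := by
    rw [hEpow]
    refine hmono ?_
    have e : γ - 1 ≤ -(σ / m) := by
      rw [le_neg, div_le_iff₀ hm0]; linarith
    have e2 : σ / m - σ = -(σ / m) * (m - 1) := by field_simp; ring
    rw [e2]
    exact mul_le_mul_of_nonneg_right e (by linarith)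
  have hE1σ : δ ^ (1 - σ) ≤ E ^ (m - 1) := (hmono (by linarith [hσm.2])).trans hEs
  rw [← hE] at hp
  have hT0 : 0 < T := by linarith
  have hEp : E ≤ ‖p‖ / T := by rw [le_div_iff₀ hT0]; linarith
  have hP0 : 0 < ‖p‖ := lt_of_lt_of_le (by positivity) hp
  have hin' : (|C₂ R 1| + |C₂ R 2|) * (‖p‖ + H * δ) * δ ^ (1 - σ) ≤
      (|C₂ R 1| + |C₂ R 2|) * (1 + κ) * (‖p‖ * E ^ (m - 1)) := by
    calc _ ≤ (|C₂ R 1| + |C₂ R 2|) * (‖p‖ + κ * ‖p‖) * E ^ (m - 1) := by gcongr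
      _ = _ := by ring
  have hout1 : M * (C₁ R 0 * δ ^ (-σ)) ≤ M * |C₁ R 0| * E ^ m := by
    rw [mul_assoc]; gcongr; exact le_abs_self _
  have hout2 : ‖p‖ * (C₁ R (σ / m) * δ ^ (σ / m - σ)) ≤
      |C₁ R (σ / m)| * (‖p‖ * E ^ (m - 1)) := by
    rw [mul_left_comm]; gcongr; exact le_abs_self _
  have hf : A * (bdryDist Ω y ^ (-θ) + 1) ≤ 2 * A * E ^ m := by
    calc _ ≤ A * (E ^ m + E ^ m) := by gcongr
      _ = _ := by ring
  have hmain : b₀ * ‖p‖ ^ m ≤ G * E ^ m + B * (‖p‖ * E ^ (m - 1)) := by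
    rw [hG, hB]; linarith
  have hpm : ‖p‖ * ‖p‖ ^ (m - 1) = ‖p‖ ^ m := by
    rw [mul_comm, ← Real.rpow_add_one hP0.ne']; ring_nf
  have hpm0 := Real.rpow_pos_of_pos hP0 m
  have hTm0 : 0 < T ^ (m - 1) := Real.rpow_pos_of_pos hT0 _
  have hEm1 : ‖p‖ * E ^ (m - 1) ≤ ‖p‖ ^ m / T ^ (m - 1) := by
    rw [← hpm, mul_div_assoc, ← Real.div_rpow hP0.le hT0.le]
    have : 0 ≤ m - 1 := by linarith
    gcongr
  have hEm : E ^ m ≤ ‖p‖ ^ m / T ^ (m - 1) := by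
    refine le_trans ?_ hEm1
    have e : E ^ m = E * E ^ (m - 1) := by
      rw [mul_comm, ← Real.rpow_add_one hE0.ne']; ring_nf
    rw [e]
    gcongr
    nlinarith
  have hfin : b₀ * ‖p‖ ^ m ≤ (G + B) * (‖p‖ ^ m / T ^ (m - 1)) := by
    calc _ ≤ _ := hmain
      _ ≤ G * (‖p‖ ^ m / T ^ (m - 1)) + B * (‖p‖ ^ m / T ^ (m - 1)) := by gcongr
      _ = _ := by ring
  rw [← mul_div_assoc, le_div_iff₀ hTm0] at hfin
  have := mul_lt_mul_of_pos_right hT hpm0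
  linarith

/-- A function that is not touched from above by steep paraboloids stays below the barrier. -/
lemma sub_le_barrier {u : RN N → ℝ} (husc : UpperSemicontinuousOn u Ω)
    (hub : ∃ c : ℝ, ∀ x, |u x| ≤ c) {γ T : ℝ} (hγ : 0 < γ) (hγ1 : γ ≤ 1) (hT : 1 ≤ T)
    (hno : ∀ y : RN N, ∀ δ ∈ Ioo (0 : ℝ) 1, ball y δ ⊆ Ω → ∀ p : RN N, ∀ H : ℝ, 0 ≤ H →
      T * δ ^ (γ - 1) ≤ ‖p‖ → H * δ ≤ 10 / γ * ‖p‖ →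
      ¬ ∀ z ∈ ball y δ, u z ≤ u y + (inner ℝ p (z - y) + H * ‖z - y‖ ^ 2))
    {x₀ : RN N} {ρ : ℝ} (hρ : 0 < ρ) (hρ1 : ρ ≤ 1) (hball : ball x₀ ρ ⊆ Ω) {x : RN N}
    (hx : x ∈ ball x₀ ρ) : u x - u x₀ ≤ 64 * T / γ * barrier γ ρ (x - x₀) := by
  obtain ⟨c, hc⟩ := hub
  -- This multiple turns the slope `γ / 64 * δ ^ (γ - 1)` of the barrier into the forbidden `T * δ ^
  -- (γ - 1)`.
  obtain ⟨L, hL⟩ : ∃ L, L = 64 * T / γ := ⟨_, rfl⟩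
  have hL0 : 0 < L := hL ▸ by positivity
  rw [← hL]
  by_contra! hlt
  -- Beyond this level `u - L * barrier` is below `c - 2 * c ≤ u x₀`, so its supremum is attained in
  -- a smaller closed ball.
  obtain ⟨ρ', hρ', hbar⟩ := exists_radius_lt_barrier (E := RN N) (γ := γ) hρ (2 * c / L)
  have hle : ∀ y ∈ ball x₀ ρ, ρ' < ‖y - x₀‖ → u y - L * barrier γ ρ (y - x₀) < u x₀ := by
    intro y hy hy'
    rw [mem_ball, dist_eq_norm] at hy
    have h := hbar _ hy' hy
    rw [div_lt_iff₀ hL0] at h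
    have h1 := (abs_le.1 (hc y)).2
    have h2 := (abs_le.1 (hc x₀)).1
    linarith
  have hxρ' : x ∈ closedBall x₀ ρ' := by
    by_contra h
    rw [mem_closedBall, dist_eq_norm, not_le] at h
    linarith [hle x hx h]
  have hsub : closedBall x₀ ρ' ⊆ ball x₀ ρ := closedBall_subset_ball hρ'
  have husc' : UpperSemicontinuousOn (fun y => u y + -(L * barrier γ ρ (y - x₀)))
      (closedBall x₀ ρ') := by
    refine (husc.mono (hsub.trans hball)).add (ContinuousOn.upperSemicontinuousOn ?_)
    refine (continuousOn_const.mul ((continuousOn_barrier hγ).comp (by fun_prop) ?_)).neg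
    intro y hy
    have := hsub hy
    rw [mem_ball, dist_eq_norm] at this
    exact mem_ball_zero_iff.2 this
  obtain ⟨y, hy, hmax⟩ := husc'.exists_isMaxOn ⟨x, hxρ'⟩ (isCompact_closedBall x₀ ρ')
  have hyx : u x - L * barrier γ ρ (x - x₀) ≤ u y - L * barrier γ ρ (y - x₀) := by
    have : u x + -(L * barrier γ ρ (x - x₀)) ≤ u y + -(L * barrier γ ρ (y - x₀)) := hmax hxρ'
    linarith
  have hmax' : ∀ z ∈ ball x₀ ρ,
      u z - L * barrier γ ρ (z - x₀) ≤ u y - L * barrier γ ρ (y - x₀) := by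
    intro z hz
    by_cases hz' : z ∈ closedBall x₀ ρ'
    · have : u z + -(L * barrier γ ρ (z - x₀)) ≤ u y + -(L * barrier γ ρ (y - x₀)) := hmax hz'
      linarith
    · rw [mem_closedBall, dist_eq_norm, not_le] at hz'
      linarith [hle z hz hz']
  -- At the centre the value is `u x₀`, strictly less than the value at `x`.
  have hy0 : y - x₀ ≠ 0 := by
    intro h
    rw [h, barrier_zero hγ, sub_eq_zero.1 h] at hyx
    linarith
  have hyρ := hsub hy
  rw [mem_ball, dist_eq_norm] at hyρ
  obtain ⟨δ, hδ0, hδρ, hyδ, p, H, hH, hp, hHp, hsemi⟩ :=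
    barrier_semiconcave hγ hγ1 hy0 hyρ
  have hsubδ : ball y δ ⊆ ball x₀ ρ := ball_subset_ball' (by rw [dist_eq_norm]; linarith)
  have hLp : ‖L • p‖ = L * ‖p‖ := by rw [norm_smul, Real.norm_of_nonneg hL0.le]
  refine hno y δ ⟨hδ0, by linarith⟩ (hsubδ.trans hball) (L • p) (L * H) (by positivity) ?_ ?_ ?_
  · rw [hLp]
    calc T * δ ^ (γ - 1) = L * (γ / 64 * δ ^ (γ - 1)) := by rw [hL]; field_simp
      _ ≤ _ := by gcongr
  · rw [hLp]
    calc L * H * δ = L * (H * δ) := by ring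
      _ ≤ L * (10 / γ * ‖p‖) := by gcongr
      _ = _ := by ring
  · intro z hz
    have h1 := hmax' z (hsubδ hz)
    rw [mem_ball, dist_eq_norm] at hz
    have h2 := hsemi (z - y) hz.le
    have e : y - x₀ + (z - y) = z - x₀ := by abel
    rw [e] at h2
    have h3 := mul_le_mul_of_nonneg_left h2 hL0.le
    rw [real_inner_smul_left]
    linarith

/-- The barrier bounds `u` only from above; the lower bound comes from centring it at `y` instead,
in a ball of half the radius. -/
lemma localHolder_of_sub_le_barrier {u : RN N → ℝ} {γ L : ℝ} (hγ : 0 < γ) (hγ1 : γ ≤ 1)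
    (hL : 0 ≤ L) (hM : ∀ x ∈ Ω, ∀ y ∈ Ω, |u x - u y| ≤ M)
    (hbar : ∀ (x₀ : RN N) (ρ : ℝ), 0 < ρ → ρ ≤ 1 → ball x₀ ρ ⊆ Ω → ∀ x ∈ ball x₀ ρ,
      u x - u x₀ ≤ L * barrier γ ρ (x - x₀)) :
    LocalHolder (max (3 * L) (M * 4 ^ γ)) γ u Ω := by
  have hone : ∀ (x₀ : RN N) (ρ : ℝ), 0 < ρ → ρ ≤ 1 → ball x₀ ρ ⊆ Ω → ∀ x,
      ‖x - x₀‖ ≤ ρ / 2 → u x - u x₀ ≤ 3 * L * ‖x - x₀‖ ^ γ := by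
    intro x₀ ρ hρ hρ1 hΩ x hx
    refine (hbar x₀ ρ hρ hρ1 hΩ x (by rw [mem_ball, dist_eq_norm]; linarith)).trans ?_
    calc _ ≤ L * (3 * ‖x - x₀‖ ^ γ) :=
          mul_le_mul_of_nonneg_left (barrier_le hγ hγ1 hρ hx) hL
      _ = _ := by ring
  intro x ρ hΩ y hy
  rcases eq_or_ne y x with rfl | hxy
  · simp [Real.zero_rpow hγ.ne']
  have ht : 0 < ‖y - x‖ := norm_pos_iff.2 (sub_ne_zero.2 hxy)
  have hρ : 0 < ρ := by linarith
  have hxΩ : x ∈ Ω := hΩ (mem_ball_self hρ)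
  have hyΩ : y ∈ Ω := hΩ (by rw [mem_ball, dist_eq_norm]; linarith)
  -- The barrier is available only for radii up to `1`; points farther apart are handled by the
  -- oscillation, whence `M * 4 ^ γ`.
  rcases le_or_gt (1 / 4) ‖y - x‖ with h | h
  · have hM0 : 0 ≤ M := (abs_nonneg _).trans (hM y hyΩ x hxΩ)
    have h4 : 1 ≤ 4 ^ γ * ‖y - x‖ ^ γ := by
      rw [← Real.mul_rpow (by norm_num) ht.le]
      exact Real.one_le_rpow (by linarith) hγ.le
    calc |u y - u x| ≤ M * 1 := by rw [mul_one]; exact hM y hyΩ x hxΩ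
      _ ≤ M * (4 ^ γ * ‖y - x‖ ^ γ) := by gcongr
      _ = M * 4 ^ γ * ‖y - x‖ ^ γ := by ring
      _ ≤ _ := by gcongr; exact le_max_right _ _
  · obtain ⟨r, hr⟩ : ∃ r, r = min ρ 1 := ⟨_, rfl⟩
    have hr0 : 0 < r := hr ▸ lt_min hρ one_pos
    have hr1 : r ≤ 1 := hr ▸ min_le_right _ _
    have hrρ : r ≤ ρ := hr ▸ min_le_left _ _
    have hyr : ‖y - x‖ ≤ r / 4 := by
      have : 4 * ‖y - x‖ ≤ r := hr ▸ le_min (by linarith) (by linarith)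
      linarith
    have h1 := hone x r hr0 hr1 ((ball_subset_ball hrρ).trans hΩ) y (by linarith)
    have h2 := hone y (r / 2) (by linarith) (by linarith)
      ((ball_subset_ball' (by rw [dist_eq_norm]; linarith)).trans hΩ) x
      (by rw [norm_sub_rev]; linarith)
    rw [norm_sub_rev x y] at h2
    have h3 : |u y - u x| ≤ 3 * L * ‖y - x‖ ^ γ := by
      rw [abs_le]; constructor <;> linarith
    refine h3.trans ?_
    gcongr
    exact le_max_left _ _

end Touching

/-! ### Conclusion. -/

theorem mainTheorem3 (N : ℕ) (hN : 0 < N) (Ω : Set (RN N)) (hΩo : IsOpen Ω)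
    (hΩc : IsConnected Ω) (hΩb : Bornology.IsBounded Ω)
    (A b₀ σ m θ : ℝ) (hA : 0 < A) (hb₀ : 0 < b₀) (hσ : σ ∈ Ioo (0 : ℝ) 2)
    (hm : max 1 σ < m) (hθ : θ ∈ Ico 0 m)
    (C₁ C₂ : ℝ → ℝ → ℝ) (M : ℝ) :
    ∃ K : ℝ, 0 ≤ K ∧
      ∀ ν : RN N → Measure (RN N), CondM1 σ ν C₁ → CondM2 σ ν C₂ →
      ∀ u : RN N → ℝ, Measurable u → (∃ c : ℝ, ∀ x, |u x| ≤ c) →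
        IsViscositySubsolution Ω σ ν b₀ m (fun x => A * (bdryDist Ω x ^ (-θ) + 1)) u →
        oscOn u (reachSet Ω ν) ≤ M →
          (∀ (x₀ : RN N) (r : ℝ), ball x₀ r ⊆ Ω →
            HolderBoundOn K (holderExp m σ θ) u (ball x₀ r)) ∧
          (HasC11Boundary Ω →
            ∃ v : RN N → ℝ, EqOn v u Ω ∧ HolderBoundOn K (holderExp m σ θ) v (closure Ω)) := by
  have hm0 : 0 < m := zero_lt_one.trans ((le_max_left _ _).trans_lt hm)
  have hγσ := holderExp_mul_le_left (σ := σ) (θ := θ) hm0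
  have hγθ := holderExp_mul_le_right (σ := σ) (θ := θ) hm0
  have hγ : 0 < holderExp m σ θ := holderExp_pos hm0 ((le_max_right _ _).trans_lt hm) hθ.2
  obtain ⟨γ, hγdef⟩ : ∃ γ, γ = holderExp m σ θ := ⟨_, rfl⟩
  rw [← hγdef] at hγ hγσ hγθ ⊢
  have hγ1 : γ ≤ 1 := le_of_mul_le_mul_right (by linarith [hσ.1]) hm0
  -- `M` may be negative, so `|M|` serves as the oscillation bound.
  have hM' : 0 ≤ |M| := abs_nonneg M
  obtain ⟨T, hT1, hT⟩ := exists_no_steep_paraboloid (C₁ := C₁) (C₂ := C₂) hN hΩo hΩb hA hb₀ hσ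
    hm hθ.1 hM' hγσ hγθ (show 0 ≤ 10 / γ by positivity)
  have hL : 0 ≤ 64 * T / γ := by positivity
  obtain ⟨C, hC⟩ : ∃ C, C = max (3 * (64 * T / γ)) (|M| * 4 ^ γ) := ⟨_, rfl⟩
  have hC0 : 0 ≤ C := hC ▸ le_max_of_le_left (by positivity)
  obtain ⟨K₁, hK₁, hball⟩ := LocalHolder.exists_bound_on_balls hC0 hγ hΩo
  -- The constant must be fixed before `ν` and `u`, hence the case split on the regularity of `Ω`
  -- here.
  obtain ⟨K₂, hK₂, hclos⟩ : ∃ K : ℝ, 0 ≤ K ∧ (HasC11Boundary Ω → ∀ u : RN N → ℝ,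
      LocalHolder C γ u Ω → (∀ x ∈ Ω, ∀ y ∈ Ω, |u x - u y| ≤ |M|) →
      ∀ x ∈ Ω, ∀ y ∈ Ω, |u x - u y| ≤ K * ‖x - y‖ ^ γ) := by
    by_cases h : HasC11Boundary Ω
    · obtain ⟨K, hK, hu⟩ := LocalHolder.exists_bound_of_hasInteriorCones hC0 hγ hΩo
        hΩb.isCompact_closure (fun p hp => h.hasInteriorCones hΩo hp) hM'
      exact ⟨K, hK, fun _ => hu⟩
    · exact ⟨0, le_rfl, fun h' => absurd h' h⟩
  refine ⟨max K₁ K₂, le_max_of_le_left hK₁, fun ν h1 h2 u _ hub hu hosc => ?_⟩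
  have hosc' : oscOn u (reachSet Ω ν) ≤ |M| := hosc.trans (le_abs_self M)
  have huM : ∀ x ∈ Ω, ∀ y ∈ Ω, |u x - u y| ≤ |M| := by
    obtain ⟨c, hc⟩ := hub
    exact fun x hx y hy =>
      (abs_sub_le_oscOn hc (subset_reachSet hx) (subset_reachSet hy)).trans hosc'
  have hloc : LocalHolder C γ u Ω := hC ▸ localHolder_of_sub_le_barrier hγ hγ1 hL huM
    fun x₀ ρ hρ hρ1 hΩ x hx =>
      sub_le_barrier hu.1 hub hγ hγ1 hT1 (hT ν h1 h2 u hub hu hosc') hρ hρ1 hΩ hx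
  refine ⟨fun x₀ r hr x hx y hy => ?_, fun h => ?_⟩
  · refine (hball u hloc x₀ r hr x hx y hy).trans ?_
    gcongr; exact le_max_left _ _
  · obtain ⟨v, hvu, hv⟩ := exists_holder_extension hK₂ hγ hγ1 hΩc.nonempty (hclos h u hloc huM)
    refine ⟨v, hvu, fun x _ y _ => (hv x y).trans ?_⟩
    gcongr; exact le_max_right _ _
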